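/- Let $P$ be the transition matrix of an irreducible Markov chain on a finite state space $V$ with $|V|\ge 2$, reversible with respect to its stationary distribution $\pi$, i.e. $\pi(x)P(x,y)=\pi(y)P(y,x)$ for all $x,y\in V$. Let $0=\lambda_1<\lambda_2\le\dots\le\lambda_{|V|}$ be the eigenvalues of $I-P$, counted with multiplicity, and let $\mathrm{gap}:=\lambda_2$. Let $(X_t)_{t\ge 0}$ be the rate $1$ continuous-time version of the chain (the chain jumps according to $P$ after independent exponential holding times of mean $1$), and let $\mathbb E_x$ be the expectation when it starts from $x$. Put $$T_y:=\inf\{t\ge 0: X_t=y\},\qquad \tau_{\mathrm{cov}}:=\inf\{t\ge 0:\{X_s:s\le t\}=V\},$$ $$H:=\max_{x,y\in V}\mathbb E_x[T_y],\qquad t_{\mathrm{cov}}:=\max_{x\in V}\mathbb E_x[\tau_{\mathrm{cov}}],\qquad \alpha_y:=\sum_{x\in V}\pi(x)\mathbb E_x[T_y],$$ $$\alpha:=\sum_{x,y\in V}\pi(x)\pi(y)\mathbb E_x[T_y],\qquad \pi_*:=\max_{x\in V}\pi(x).$$ All the expectations $\mathbb E_x[T_y]$ and $\mathbb E_x[\tau_{\mathrm{cov}}]$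 are finite. For every $x\in V$ and $\varepsilon\in(0,1)$, the set $$B(x,\varepsilon):=\{z\in V:\ \mathbb E_z[T_x]\le\alpha_x-\varepsilon\alpha,\ \ \mathbb E_x[T_z]\le\alpha_z-\varepsilon\alpha\}$$ satisfies $$\pi(B(x,\varepsilon))\le\frac{2\log\left(\frac{2H}{\varepsilon\alpha}\right)}{2\log\left(\frac{2H}{\varepsilon\alpha}\right)+\varepsilon\,\alpha\,\mathrm{gap}}.$$ Moreover $$t_{\mathrm{cov}}\ge\frac{\alpha}{4}\log\left(M\left(\frac{H}{\alpha},\ \alpha\,\mathrm{gap},\ \pi_*\right)\right),\qquad\text{where}\quad M(a,b,c):=\frac{1/(4a)}{c+\frac{8\log(8a)}{8\log(8a)+b}}.$$ The same statements hold when $(X_t)$ is replaced by the discrete-time chain with transition matrix $P$, with times $t\in\{0,1,2,\dots\}$ in the definitions of $T_y$ and $\tau_{\mathrm{cov}}$. -/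

import Mathlib

open MeasureTheory ProbabilityTheory
open scoped ENNReal NNReal

noncomputable section

namespace RevChain

/-- A Markov chain on a finite state space `V`, given by its (row-stochastic) transition
matrix `P`. -/
structure Chain (V : Type*) [Fintype V] where
  P : Matrix V V ℝ
  nonneg : ∀ x y, 0 ≤ P x y
  row_sum : ∀ x, ∑ y, P x y = 1

section Law

variable {V : Type*} [Fintype V] [MeasurableSpace V] [DiscreteMeasurableSpace V]

/-- The one-step transition kernel `x ↦ P(x, ·)`. -/
def Chain.kernel (C : Chain V) : Kernel V V where
  toFun x := ∑ y, ENNReal.ofReal (C.P x y) • Measure.dirac y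
  measurable' := Measurable.of_discrete

instance (C : Chain V) : IsMarkovKernel C.kernel where
  isProbabilityMeasure x := ⟨by
    change (∑ y, ENNReal.ofReal (C.P x y) • Measure.dirac y : Measure V) Set.univ = 1
    simp only [Measure.coe_finsetSum, Measure.coe_smul, Finset.sum_apply, Pi.smul_apply,
      measure_univ, smul_eq_mul, mul_one]
    rw [← ENNReal.ofReal_sum_of_nonneg fun y _ => C.nonneg x y, C.row_sum, ENNReal.ofReal_one]⟩

/-- The kernel giving the law of the state at time `n + 1` from the history up to time `n`;
it depends on the state at time `n` only. -/
def Chain.historyKernel (C : Chain V) (n : ℕ) :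
    Kernel ((i : Finset.Iic n) → (fun _ : ℕ => V) i) V :=
  C.kernel.comap (fun h => h ⟨n, Finset.mem_Iic.2 le_rfl⟩) (measurable_pi_apply _)

instance (C : Chain V) (n : ℕ) : IsMarkovKernel (C.historyKernel n) := by
  unfold Chain.historyKernel
  infer_instance

/-- The law on `V^ℕ` of the discrete-time chain `(Y_n)` started from `x`. -/
def Chain.discLaw (C : Chain V) (x : V) : Measure (ℕ → V) :=
  Kernel.traj (X := fun _ => V) C.historyKernel 0 (fun _ => x)

instance : IsProbabilityMeasure (expMeasure 1) := isProbabilityMeasure_expMeasure one_pos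

/-- The joint law of the jump chain `(Y_n)` started from `x` and of an independent sequence of
independent holding times, which are exponential of rate `1`. -/
def Chain.contLaw (C : Chain V) (x : V) : Measure ((ℕ → V) × (ℕ → ℝ)) :=
  (C.discLaw x).prod (Measure.infinitePi fun _ : ℕ => expMeasure 1)

end Law

section Paths

/-- The time of the `n`-th jump, when the holding times are `ξ`. -/
def jumpTime (ξ : ℕ → ℝ) (n : ℕ) : ℝ := ∑ i ∈ Finset.range n, ξ i

/-- The number of jumps up to time `t`. -/
def jumpCount (ξ : ℕ → ℝ) (t : ℝ≥0) : ℕ := sSup {n | jumpTime ξ n ≤ t}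

/-- The path `t ↦ X_t` of the rate 1 continuous-time chain with jump chain `ω.1` and
holding times `ω.2`. -/
def contPath {V : Type*} (ω : (ℕ → V) × (ℕ → ℝ)) (t : ℝ≥0) : V := ω.1 (jumpCount ω.2 t)

/-- `T_y = inf {t : X_t = y}` for a path `X`; `clock` is the inclusion of the set of times
into `[0, ∞]`. -/
def hittingTime {ι V : Type*} (clock : ι → ℝ≥0∞) (X : ι → V) (y : V) : ℝ≥0∞ :=
  ⨅ (t : ι) (_ : X t = y), clock t

/-- `τ_cov = inf {t : {X_s : s ≤ t} = V}` for a path `X`. -/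
def coverTime {ι V : Type*} [Preorder ι] (clock : ι → ℝ≥0∞) (X : ι → V) : ℝ≥0∞ :=
  ⨅ (t : ι) (_ : X '' Set.Iic t = Set.univ), clock t

end Paths

/-- The two versions of a chain: the discrete-time chain, and its rate 1 continuous-time
version. -/
inductive TimeModel
  | discrete
  | continuous

section Quantities

variable {V : Type*} [Fintype V] [MeasurableSpace V] [DiscreteMeasurableSpace V]

/-- `E_x[T_y]`, as an extended number. -/
def expHit (C : Chain V) (m : TimeModel) (x y : V) : ℝ≥0∞ :=
  match m with
  | .discrete => ∫⁻ ω, hittingTime (fun n : ℕ => (n : ℝ≥0∞)) ω y ∂(C.discLaw x)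
  | .continuous => ∫⁻ ω, hittingTime (fun t : ℝ≥0 => (t : ℝ≥0∞)) (contPath ω) y ∂(C.contLaw x)

/-- `E_x[τ_cov]`, as an extended number. -/
def expCover (C : Chain V) (m : TimeModel) (x : V) : ℝ≥0∞ :=
  match m with
  | .discrete => ∫⁻ ω, coverTime (fun n : ℕ => (n : ℝ≥0∞)) ω ∂(C.discLaw x)
  | .continuous => ∫⁻ ω, coverTime (fun t : ℝ≥0 => (t : ℝ≥0∞)) (contPath ω) ∂(C.contLaw x)

/-- `E_x[T_y]`, as a real number. -/
def hit (C : Chain V) (m : TimeModel) (x y : V) : ℝ := (expHit C m x y).toReal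

/-- `H = max_{x,y} E_x[T_y]`. -/
def maxHit (C : Chain V) (m : TimeModel) : ℝ := ⨆ p : V × V, hit C m p.1 p.2

/-- `t_cov = max_x E_x[τ_cov]`. -/
def tCov (C : Chain V) (m : TimeModel) : ℝ := ⨆ x : V, (expCover C m x).toReal

/-- `α_y = E_π[T_y]`. -/
def alphaAt (C : Chain V) (m : TimeModel) (π : V → ℝ) (y : V) : ℝ := ∑ x, π x * hit C m x y

/-- `α = ∑_{x,y} π(x) π(y) E_x[T_y]`. -/
def alpha (C : Chain V) (m : TimeModel) (π : V → ℝ) : ℝ := ∑ x, ∑ y, π x * π y * hit C m x y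

/-- The set `B(x, ε)`. -/
def B (C : Chain V) (m : TimeModel) (π : V → ℝ) (x : V) (ε : ℝ) : Set V :=
  {z | hit C m z x ≤ alphaAt C m π x - ε * alpha C m π ∧
    hit C m x z ≤ alphaAt C m π z - ε * alpha C m π}

end Quantities

section Stationary

variable {V : Type*} [Fintype V]

/-- `π` is a probability vector with `π P = π`. -/
def IsStationary (C : Chain V) (π : V → ℝ) : Prop :=
  π ∈ stdSimplex ℝ V ∧ Matrix.vecMul π C.P = π

/-- Detailed balance. -/
def IsReversible (C : Chain V) (π : V → ℝ) : Prop :=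
  ∀ x y, π x * C.P x y = π y * C.P y x

/-- `π(A)`. -/
def mass (π : V → ℝ) (A : Set V) : ℝ := ∑ z, A.indicator π z

/-- `π_* = max_x π(x)`. -/
def piMax (π : V → ℝ) : ℝ := ⨆ x, π x

/-- The spectral gap `λ₂`: the second entry in the nondecreasing list
`λ₁ ≤ λ₂ ≤ ⋯` of the eigenvalues of `I - P`, counted with multiplicity
(`0` by convention if there is no second entry). -/
def gap [DecidableEq V] (C : Chain V) : ℝ :=
  ((1 - C.P).charpoly.roots.sort (· ≤ ·)).getD 1 0

end Stationary

/-- `M(a, b, c) = (1 / (4a)) / (c + 8 log(8a) / (8 log(8a) + b))`. -/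
def M (a b c : ℝ) : ℝ :=
  (1 / (4 * a)) / (c + 8 * Real.log (8 * a) / (8 * Real.log (8 * a) + b))

end RevChain

end

/-! The chain is studied in discrete time. Its hitting and cover times are numbers of jumps, and the
holding times of the continuous-time chain are independent of the jumps and have mean `1`, so both
models have the same expectations (`expHit_eq`, `expCover_eq`).

Let `G` be the density with respect to `π` of the inverse of `I - P` on functions of mean zero. Then
`E_x[T_y] = G(y, y) - G(x, y)` and `α_y = G(y, y)` (`visitCost_singleton_eq`), and by reversibility
`G` is symmetric. Hence both conditions that define `B(x, ε)` say that `G(x, z) ≥ s := ε α`. Now `G`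
is the integral over time of `h_u(x, z) - 1`, where `h` is the heat kernel, and by the spectral gap
the part beyond `t := log (2H/s) / gap` is at most `s / 2`. So the chain started from `x` spends in
`B(x, ε)` at least `(s/2 + t) π(B(x, ε))` of the time up to `t`, and this is at most `t`
(`SpectralData.mass_le_of_le_green`).

For the cover time, take `ε = 1/4` and a maximal set `A` of points with `α_y ≥ α/2` none of which
lies in `B(x, 1/4)` for another point `x` of `A`. The hitting times between points of `A` are at
least `α/4`, and `A` has at least `M(H/α, α gap, π_*)` points, because Markov's inequality bounds
the mass of `{α_y ≥ α/2}` from below and the sets `B(x, 1/4)` are small (`exists_separated`).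
Matthews' argument (`mul_log_card_le_visitCost`) gives the bound. Its probabilistic step, an
application of the strong Markov property, is proved by the maximum principle for irreducible chains
(`nonpos_of_subharmonic`). -/

namespace RevChain

/-! ### The law of the discrete-time chain -/

section Law

variable {V : Type*} [Fintype V] [MeasurableSpace V] [DiscreteMeasurableSpace V]

instance (C : Chain V) (x : V) : IsProbabilityMeasure (C.discLaw x) := by
  unfold Chain.discLaw
  infer_instance

lemma kernel_singleton (C : Chain V) (x y : V) :
    C.kernel x {y} = ENNReal.ofReal (C.P x y) := by
  classical
  change (∑ z, ENNReal.ofReal (C.P x z) • Measure.dirac z : Measure V) {y} = _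
  simp [Measure.coe_finsetSum, Finset.sum_apply, Set.indicator_apply]

lemma discLaw_ae_start (C : Chain V) (x : V) : ∀ᵐ ω ∂(C.discLaw x), ω 0 = x := by
  have h := Kernel.traj_map_frestrictLe_apply (X := fun _ => V) (κ := C.historyKernel) 0 0
    (fun _ => x)
  rw [Kernel.partialTraj_self, Kernel.id_apply] at h
  have h2 : ∀ᵐ u ∂((C.discLaw x).map (Preorder.frestrictLe (π := fun _ => V) 0)),
      u ⟨0, by simp⟩ = x := by
    unfold Chain.discLaw
    rw [h, ae_dirac_iff (MeasurableSet.of_discrete)]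
  exact ae_of_ae_map (Preorder.measurable_frestrictLe 0).aemeasurable h2

lemma discLaw_cylinder_succ (C : Chain V) (x : V) (v : ℕ → V) (n : ℕ) :
    C.discLaw x {ω | ∀ i ≤ n + 1, ω i = v i} =
      C.discLaw x {ω | ∀ i ≤ n, ω i = v i} * ENNReal.ofReal (C.P (v n) (v (n + 1))) := by
  have h := Kernel.partialTraj_compProd_eq_map_traj (X := fun _ => V) (κ := C.historyKernel)
    (Nat.zero_le n) (x₀ := fun _ => x)
  have hm := Kernel.traj_map_frestrictLe_apply (X := fun _ => V) (κ := C.historyKernel) 0 n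
    (fun _ => x)
  set u : (i : Finset.Iic n) → V := fun i => v i with hu
  have hS : MeasurableSet (({u} : Set ((i : Finset.Iic n) → V)) ×ˢ ({v (n + 1)} : Set V)) :=
    .of_discrete
  have h1 := DFunLike.congr_fun h (({u} : Set ((i : Finset.Iic n) → V)) ×ˢ {v (n + 1)})
  have hf : ∀ ω : ℕ → V, Preorder.frestrictLe (π := fun _ => V) n ω = u ↔
      ∀ i ≤ n, ω i = v i := by
    intro ω
    simp [funext_iff, hu]
  rw [Measure.map_apply (by fun_prop) hS, Measure.compProd_apply_prod .of_discrete .of_discrete,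
    lintegral_singleton, ← hm, Measure.map_apply (by fun_prop) .of_discrete] at h1
  unfold Chain.discLaw
  rw [mul_comm] at h1
  convert h1.symm using 2
  · ext ω
    simp only [Set.mem_ofPred_eq, Set.mem_preimage, Set.mem_prod, Set.mem_singleton_iff, hf]
    constructor
    · intro H
      exact ⟨fun i hi => H i (by omega), H _ le_rfl⟩
    · rintro ⟨H, H'⟩ i hi
      rcases Nat.lt_or_ge n i with h | h
      · obtain rfl : i = n + 1 := by omega
        exact H'
      · exact H i h
  · congr 1
    ext ω
    simp [hf]
  · exact (kernel_singleton C _ _).symm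

/-- The probability of an initial segment of the path. -/
lemma discLaw_cylinder [DecidableEq V] (C : Chain V) (x : V) (v : ℕ → V) (n : ℕ) :
    C.discLaw x {ω | ∀ i ≤ n, ω i = v i} =
      (if x = v 0 then 1 else 0) *
        ∏ i ∈ Finset.range n, ENNReal.ofReal (C.P (v i) (v (i + 1))) := by
  induction n with
  | zero =>
    simp only [Nat.le_zero, forall_eq, Finset.range_zero, Finset.prod_empty, mul_one]
    split_ifs with h
    · rw [prob_compl_eq_zero_iff (by measurability) |>.symm]
      filter_upwards [discLaw_ae_start C x] with ω hω
      simp [hω, h]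
    · refine measure_mono_null ?_ (discLaw_ae_start C x)
      intro ω hω hx
      exact h (hx.symm.trans hω)
  | succ n ih => rw [discLaw_cylinder_succ, ih, Finset.prod_range_succ, mul_assoc]

/-- A finite measure on `V^ℕ` is determined by the probabilities of the initial segments. -/
lemma ext_of_cylinder {μ ν : Measure (ℕ → V)} [IsFiniteMeasure μ] [IsFiniteMeasure ν]
    (h : ∀ (n : ℕ) (v : ℕ → V), μ {ω | ∀ i ≤ n, ω i = v i} = ν {ω | ∀ i ≤ n, ω i = v i}) :
    μ = ν := by
  have key : IsProjectiveLimit μ (fun I => ν.map I.restrict) := by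
    rw [isProjectiveLimit_nat_iff]
    · intro n
      refine Measure.ext_of_singleton fun u => ?_
      have hne : Nonempty V := ⟨u ⟨n, by simp⟩⟩
      let v : ℕ → V := fun i =>
        if hi : i ≤ n then u ⟨i, Finset.mem_Iic.2 hi⟩ else Classical.arbitrary V
      have hset : (Finset.Iic n).restrict (π := fun _ => V) ⁻¹' {u} =
          {ω : ℕ → V | ∀ i ≤ n, ω i = v i} := by
        ext ω
        simp only [Set.mem_preimage, Set.mem_singleton_iff, funext_iff, Finset.restrict,
          Set.mem_ofPred_eq, Subtype.forall, Finset.mem_Iic]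
        refine forall₂_congr fun i hi => ?_
        simp [v, hi]
      rw [Measure.map_apply (Preorder.measurable_frestrictLe n) (measurableSet_singleton u),
        Measure.map_apply (Finset.measurable_restrict _) (measurableSet_singleton u)]
      rw [show Preorder.frestrictLe (π := fun _ => V) n = (Finset.Iic n).restrict from rfl, hset]
      exact h n v
    · intro I J hJI
      rw [Measure.map_map (by fun_prop) (by fun_prop)]
      rfl
  exact key.unique fun I => rfl

/-- The Markov property at time `1`. -/
lemma map_shift_discLaw (C : Chain V) (x : V) :
    (C.discLaw x).map (fun ω n => ω (n + 1)) =
      ∑ y, ENNReal.ofReal (C.P x y) • C.discLaw y := by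
  classical
  have hmeas : Measurable (fun (ω : ℕ → V) n => ω (n + 1)) := by fun_prop
  have hfin : IsFiniteMeasure (∑ y, ENNReal.ofReal (C.P x y) • C.discLaw y) := by
    refine ⟨?_⟩
    simp [Measure.coe_finsetSum, Finset.sum_apply, ENNReal.sum_lt_top]
  have : IsFiniteMeasure ((C.discLaw x).map (fun (ω : ℕ → V) n => ω (n + 1))) := inferInstance
  refine ext_of_cylinder fun n v => ?_
  have hms : ∀ (n : ℕ) (v : ℕ → V), MeasurableSet {ω : ℕ → V | ∀ i ≤ n, ω i = v i} := by
    intro n v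
    measurability
  rw [Measure.map_apply hmeas (hms n v)]
  let w : ℕ → V := fun i => Nat.casesOn i x v
  have hw : C.discLaw x ((fun (ω : ℕ → V) n => ω (n + 1)) ⁻¹' {ω | ∀ i ≤ n, ω i = v i}) =
      C.discLaw x {ω | ∀ i ≤ n + 1, ω i = w i} := by
    refine measure_congr ?_
    filter_upwards [discLaw_ae_start C x] with ω hω
    refine propext ⟨fun H i hi => ?_, fun H i hi => H (i + 1) (by omega)⟩
    cases i with
    | zero => exact hω
    | succ i => exact H i (by omega)
  rw [hw, discLaw_cylinder, Finset.prod_range_succ']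
  simp only [Measure.coe_finsetSum, Measure.coe_smul, Finset.sum_apply, Pi.smul_apply,
    smul_eq_mul, discLaw_cylinder]
  simp [w, mul_comm]

/-- First-step analysis. -/
lemma lintegral_discLaw_step (C : Chain V) (x : V) {F G : (ℕ → V) → ℝ≥0∞} (hG : Measurable G)
    (h : ∀ ω, ω 0 = x → F ω = G (fun n => ω (n + 1))) :
    ∫⁻ ω, F ω ∂(C.discLaw x) = ∑ y, ENNReal.ofReal (C.P x y) * ∫⁻ ω, G ω ∂(C.discLaw y) := by
  have h1 : ∫⁻ ω, F ω ∂(C.discLaw x) = ∫⁻ ω, G (fun n => ω (n + 1)) ∂(C.discLaw x) := by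
    refine lintegral_congr_ae ?_
    filter_upwards [discLaw_ae_start C x] with ω hω using h ω hω
  rw [h1, ← lintegral_map hG (by fun_prop : Measurable fun (ω : ℕ → V) n => ω (n + 1)),
    map_shift_discLaw]
  simp [lintegral_finsetSum_measure, lintegral_smul_measure]

end Law

/-! ### First visits of discrete-time paths -/

section Paths

variable {V : Type*}

/-- The first `n` such that `q n`, as an extended number; it is `∞` if there is none. -/
noncomputable def firstTime (q : ℕ → Prop) : ℝ≥0∞ := ⨅ (n : ℕ) (_ : q n), (n : ℝ≥0∞)

lemma firstTime_le {q : ℕ → Prop} {n : ℕ} (h : q n) : firstTime q ≤ n := iInf₂_le n h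

lemma exists_firstTime_eq {q : ℕ → Prop} (h : firstTime q ≠ ∞) :
    ∃ n, q n ∧ (∀ k, q k → n ≤ k) ∧ firstTime q = n := by
  classical
  have hex : ∃ n, q n := by
    by_contra hne
    push Not at hne
    exact h (by simp [firstTime, hne])
  refine ⟨Nat.find hex, Nat.find_spec hex, fun k hk => Nat.find_min' hex hk, le_antisymm
    (firstTime_le (Nat.find_spec hex)) (le_iInf₂ fun k hk => ?_)⟩
  exact_mod_cast Nat.find_min' hex hk

/-- The first visit of a discrete-time path to `y`. -/
noncomputable def visitTime (ω : ℕ → V) (y : V) : ℝ≥0∞ := firstTime fun n => ω n = y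

/-- The first time at which a discrete-time path has visited all of `U`. -/
noncomputable def visitAll (ω : ℕ → V) (U : Finset V) : ℝ≥0∞ := U.sup (visitTime ω)

lemma visitTime_of_start {ω : ℕ → V} {y : V} (h : ω 0 = y) : visitTime ω y = 0 := by
  simpa [visitTime] using firstTime_le (q := fun n => ω n = y) h

lemma visitTime_shift {ω : ℕ → V} {y : V} (h : ω 0 ≠ y) :
    visitTime ω y = 1 + visitTime (fun n => ω (n + 1)) y := by
  refine le_antisymm ?_ (le_iInf₂ fun n hn => ?_)
  · rw [← tsub_le_iff_left]
    refine le_iInf₂ fun n hn => ?_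
    rw [tsub_le_iff_left]
    refine (firstTime_le (q := fun n => ω n = y) hn).trans ?_
    push_cast
    rw [add_comm]
  · cases n with
    | zero => exact absurd hn h
    | succ n =>
      push_cast
      rw [add_comm]
      gcongr
      exact firstTime_le (q := fun n => ω (n + 1) = y) hn

lemma visitAll_erase_start [DecidableEq V] (ω : ℕ → V) (U : Finset V) :
    visitAll ω U = visitAll ω (U.erase (ω 0)) := by
  refine le_antisymm (Finset.sup_le fun y hy => ?_) (Finset.sup_mono (Finset.erase_subset _ _))
  by_cases h : ω 0 = y
  · simp [visitTime_of_start h]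
  · exact Finset.le_sup (f := visitTime ω) (Finset.mem_erase.2 ⟨Ne.symm h, hy⟩)

lemma visitAll_shift {ω : ℕ → V} {U : Finset V} (hU : U.Nonempty) (h : ω 0 ∉ U) :
    visitAll ω U = 1 + visitAll (fun n => ω (n + 1)) U := by
  have key : ∀ y ∈ U, visitTime ω y = 1 + visitTime (fun n => ω (n + 1)) y :=
    fun y hy => visitTime_shift fun h0 => h (h0 ▸ hy)
  refine le_antisymm (Finset.sup_le fun y hy => ?_) ?_
  · rw [key y hy]
    gcongr
    exact Finset.le_sup (f := visitTime _) hy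
  · obtain ⟨y, hy, h1⟩ := Finset.exists_mem_eq_sup U hU (visitTime fun n => ω (n + 1))
    rw [visitAll, h1, ← key y hy]
    exact Finset.le_sup (f := visitTime ω) hy

lemma firstTime_cover [Fintype V] (ω : ℕ → V) :
    firstTime (fun n => ω '' Set.Iic n = Set.univ) = visitAll ω Finset.univ := by
  have hne : Nonempty V := ⟨ω 0⟩
  refine le_antisymm ?_ (Finset.sup_le fun y _ => le_iInf₂ fun n hn => ?_)
  · by_cases htop : visitAll ω Finset.univ = ∞
    · simp [htop]
    have hfin : ∀ y, visitTime ω y ≠ ∞ := fun y =>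
      ne_top_of_le_ne_top htop (Finset.le_sup (f := visitTime ω) (Finset.mem_univ y))
    choose N h1 _ h3 using fun y => exists_firstTime_eq (hfin y)
    obtain ⟨y, -, hy⟩ := Finset.exists_mem_eq_sup Finset.univ Finset.univ_nonempty N
    refine (firstTime_le (n := N y) ?_).trans ?_
    · refine Set.eq_univ_of_forall fun z => ⟨N z, ?_, h1 z⟩
      rw [Set.mem_Iic, ← hy]
      exact Finset.le_sup (f := N) (Finset.mem_univ z)
    · rw [← h3 y]
      exact Finset.le_sup (f := visitTime ω) (Finset.mem_univ y)
  · obtain ⟨k, hk, rfl⟩ : y ∈ ω '' Set.Iic n := hn ▸ Set.mem_univ y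
    refine (firstTime_le (q := fun n => ω n = ω k) rfl).trans ?_
    exact_mod_cast hk

lemma eq_of_visitTime_eq {ω : ℕ → V} {y z : V} (hy : visitTime ω y ≠ ∞)
    (h : visitTime ω y = visitTime ω z) : y = z := by
  obtain ⟨n, hn, -, h1⟩ := exists_firstTime_eq hy
  obtain ⟨k, hk, -, h2⟩ := exists_firstTime_eq (h ▸ hy : visitTime ω z ≠ ∞)
  have : n = k := by
    have h3 : (n : ℝ≥0∞) = k := by
      rw [← h1, ← h2]
      exact h
    exact_mod_cast h3
  rw [← hn, ← hk, this]

/-- If all the points of `U` are visited, then one of them is visited strictly last. -/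
lemma exists_visitAll_erase_lt [DecidableEq V] {ω : ℕ → V} {U : Finset V} (hU : 2 ≤ U.card)
    (hfin : ∀ y ∈ U, visitTime ω y ≠ ∞) :
    ∃ y ∈ U, visitAll ω (U.erase y) < visitTime ω y := by
  obtain ⟨y, hy, h1⟩ := Finset.exists_max_image U (visitTime ω) (Finset.card_pos.1 (by omega))
  refine ⟨y, hy, ?_⟩
  have hne : (U.erase y).Nonempty := by
    rw [← Finset.card_pos, Finset.card_erase_of_mem hy]
    omega
  obtain ⟨z, hz, h2⟩ := Finset.exists_mem_eq_sup _ hne (visitTime ω)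
  rw [visitAll, h2]
  obtain ⟨hzy, hzU⟩ := Finset.mem_erase.1 hz
  exact lt_of_le_of_ne (h1 z hzU) fun h => hzy (eq_of_visitTime_eq (hfin z hzU) h)

lemma measurable_visitTime [MeasurableSpace V] [DiscreteMeasurableSpace V] (y : V) :
    Measurable fun ω : ℕ → V => visitTime ω y := by
  classical
  have : ∀ ω : ℕ → V, visitTime ω y = ⨅ n : ℕ, if ω n = y then (n : ℝ≥0∞) else ∞ := by
    intro ω
    refine iInf_congr fun n => ?_
    by_cases h : ω n = y <;> simp [h]
  simp_rw [this]
  refine Measurable.iInf fun n => Measurable.ite ?_ measurable_const measurable_const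
  exact measurable_pi_apply (X := fun _ : ℕ => V) n (measurableSet_singleton y)

lemma measurable_visitAll [Countable V] [MeasurableSpace V] [DiscreteMeasurableSpace V]
    (U : Finset V) :
    Measurable fun ω : ℕ → V => visitAll ω U := by
  simp_rw [visitAll, Finset.sup_eq_iSup]
  exact Measurable.iSup fun y => Measurable.iSup fun _ => measurable_visitTime y

end Paths

/-! ### The continuous-time chain has the same expected hitting and cover times -/

section Clock

/-- `x` times the density of the exponential law is the density of the Gamma law with shape `2`. -/
lemma lintegral_id_expMeasure_one : ∫⁻ x, ENNReal.ofReal x ∂(expMeasure 1) = 1 := by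
  have hmeas : Measurable (gammaPDF 1 1) := (measurable_gammaPDFReal 1 1).ennreal_ofReal
  rw [expMeasure, gammaMeasure,
    lintegral_withDensity_eq_lintegral_mul _ hmeas (by fun_prop),
    ← lintegral_gammaPDF_eq_one (a := 2) (r := 1) two_pos one_pos]
  refine lintegral_congr fun x => ?_
  rcases lt_or_ge x 0 with hx | hx
  · simp [gammaPDF_of_neg hx]
  · rw [Pi.mul_apply, gammaPDF_of_nonneg hx, gammaPDF_of_nonneg hx,
      ← ENNReal.ofReal_mul (by positivity)]
    congr 1
    have : (2:ℝ) - 1 = 1 := by norm_num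
    simp [this, mul_comm]

lemma expMeasure_Iic_zero : expMeasure 1 (Set.Iic 0) = 0 := by
  have h := cdf_expMeasure_eq one_pos 0
  rw [cdf_eq_real] at h
  simpa [Measure.real, ENNReal.toReal_eq_zero_iff] using h

lemma expMeasure_Iic_one_lt : expMeasure 1 (Set.Iic 1) < 1 := by
  have h := cdf_expMeasure_eq one_pos 1
  rw [cdf_eq_real] at h
  rw [← ofReal_measureReal, h, ENNReal.ofReal_lt_one]
  simp [Real.exp_pos]

/-- The law of the holding times. -/
local notation "ℙξ" => Measure.infinitePi fun _ : ℕ => expMeasure 1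

lemma holding_pos : ∀ᵐ ξ ∂ℙξ, ∀ n, 0 < ξ n := by
  rw [ae_all_iff]
  intro n
  have h := (measurePreserving_eval_infinitePi (fun _ : ℕ => expMeasure 1) n)
  have h0 : ∀ᵐ x ∂(expMeasure 1), 0 < x := by
    have : {x : ℝ | ¬ 0 < x} = Set.Iic 0 := by ext; simp
    rw [ae_iff, this, expMeasure_Iic_zero]
  exact h.quasiMeasurePreserving.ae h0

/-- Almost surely infinitely many holding times exceed `1`, so that the jump times diverge and
`jumpCount` is never the junk value of `sSup` on an unbounded set. -/
lemma holding_gt_one : ∀ᵐ ξ ∂ℙξ, ∀ N, ∃ n ≥ N, 1 < ξ n := by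
  rw [ae_all_iff]
  intro N
  have hle : ∀ k : ℕ, ℙξ {ξ | ¬ ∃ n ≥ N, 1 < ξ n} ≤ (expMeasure 1 (Set.Iic 1)) ^ k := by
    intro k
    calc ℙξ {ξ | ¬ ∃ n ≥ N, 1 < ξ n}
        ≤ ℙξ (Set.pi (Finset.Ico N (N + k)) fun _ => Set.Iic 1) := by
          refine measure_mono fun ξ hξ n hn => ?_
          simp only [Set.mem_ofPred_eq, not_exists, not_and, not_lt] at hξ
          exact hξ n (Finset.mem_Ico.1 hn).1
      _ = _ := by
          rw [Measure.infinitePi_pi _ fun _ _ => measurableSet_Iic]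
          simp
  rw [ae_iff]
  refine le_antisymm (ge_of_tendsto' (ENNReal.tendsto_pow_atTop_nhds_zero_of_lt_one
    expMeasure_Iic_one_lt) hle) zero_le

lemma lintegral_holding (n : ℕ) : ∫⁻ ξ, ENNReal.ofReal (ξ n) ∂ℙξ = 1 := by
  have h := (measurePreserving_eval_infinitePi (fun _ : ℕ => expMeasure 1) n)
  rw [← lintegral_id_expMeasure_one, ← h.lintegral_comp (by fun_prop)]

variable {ξ : ℕ → ℝ}

lemma jumpTime_strictMono (hpos : ∀ n, 0 < ξ n) : StrictMono (jumpTime ξ) :=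
  strictMono_nat_of_lt_succ fun n => by
    simp [jumpTime, Finset.sum_range_succ, hpos n]

lemma bddAbove_jumpTime_le (hpos : ∀ n, 0 < ξ n) (hinf : ∀ N, ∃ n ≥ N, 1 < ξ n) (t : ℝ≥0) :
    BddAbove {n | jumpTime ξ n ≤ t} := by
  have h : ∀ k : ℕ, ∃ n, (k : ℝ) ≤ jumpTime ξ n := by
    intro k
    induction k with
    | zero => exact ⟨0, by simp [jumpTime]⟩
    | succ k ih =>
      obtain ⟨n, hn⟩ := ih
      obtain ⟨m, hm, h1⟩ := hinf n
      refine ⟨m + 1, ?_⟩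
      have h2 := (jumpTime_strictMono hpos).monotone hm
      rw [jumpTime, Finset.sum_range_succ, ← jumpTime]
      push_cast
      linarith
  obtain ⟨k, hk⟩ := exists_nat_gt (t : ℝ)
  obtain ⟨n, hn⟩ := h k
  refine ⟨n, fun m hm => ?_⟩
  by_contra hlt
  have := (jumpTime_strictMono hpos).monotone (not_le.1 hlt).le
  rw [Set.mem_ofPred_eq] at hm
  linarith

lemma jumpTime_jumpCount_le (hpos : ∀ n, 0 < ξ n) (hinf : ∀ N, ∃ n ≥ N, 1 < ξ n) (t : ℝ≥0) :
    jumpTime ξ (jumpCount ξ t) ≤ t :=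
  Nat.sSup_mem (s := {n | jumpTime ξ n ≤ t}) ⟨0, by simp [jumpTime]⟩
    (bddAbove_jumpTime_le hpos hinf t)

lemma jumpCount_of_eq (hpos : ∀ n, 0 < ξ n) {n : ℕ} {t : ℝ≥0} (ht : (t : ℝ) = jumpTime ξ n) :
    jumpCount ξ t = n := by
  have : {m | jumpTime ξ m ≤ t} = Set.Iic n := by
    ext m
    simp [ht, (jumpTime_strictMono hpos).le_iff_le]
  rw [jumpCount, this, csSup_Iic]

lemma jumpCount_mono (hpos : ∀ n, 0 < ξ n) (hinf : ∀ N, ∃ n ≥ N, 1 < ξ n) :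
    Monotone (jumpCount ξ) := fun s t hst =>
  csSup_le_csSup (bddAbove_jumpTime_le hpos hinf t) ⟨0, by simp [jumpTime]⟩
    fun n (hn : jumpTime ξ n ≤ s) => hn.trans (by exact_mod_cast hst)

lemma jumpTime_nonneg (hpos : ∀ n, 0 < ξ n) (n : ℕ) : 0 ≤ jumpTime ξ n :=
  Finset.sum_nonneg fun i _ => (hpos i).le

/-- The holding times of the states occupied before time `firstTime q` add up to the first
continuous time at which the number of jumps satisfies `q`. -/
lemma iInf_jumpCount (hpos : ∀ n, 0 < ξ n) (hinf : ∀ N, ∃ n ≥ N, 1 < ξ n) {q : ℕ → Prop}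
    (hq : firstTime q ≠ ∞) :
    ⨅ (t : ℝ≥0) (_ : q (jumpCount ξ t)), (t : ℝ≥0∞) =
      ∑' n : ℕ, (if (n : ℝ≥0∞) < firstTime q then 1 else 0) * ENNReal.ofReal (ξ n) := by
  obtain ⟨N, hN, hmin, hNq⟩ := exists_firstTime_eq hq
  have hsum : ∑' n : ℕ, (if (n : ℝ≥0∞) < firstTime q then 1 else 0) * ENNReal.ofReal (ξ n) =
      ENNReal.ofReal (jumpTime ξ N) := by
    rw [hNq, jumpTime, ENNReal.ofReal_sum_of_nonneg fun i _ => (hpos i).le,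
      tsum_eq_sum (s := Finset.range N)]
    · exact Finset.sum_congr rfl fun i hi => by simp [Finset.mem_range.1 hi]
    · intro i hi
      simp at hi
      simp [hi]
  rw [hsum]
  have hnn := jumpTime_nonneg hpos N
  refine le_antisymm ?_ (le_iInf₂ fun t ht => ?_)
  · refine (iInf₂_le (jumpTime ξ N).toNNReal ?_).trans le_rfl
    rw [jumpCount_of_eq hpos (Real.coe_toNNReal _ hnn)]
    exact hN
  · rw [← ENNReal.ofReal_coe_nnreal]
    exact ENNReal.ofReal_le_ofReal (((jumpTime_strictMono hpos).monotone (hmin _ ht)).trans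
      (jumpTime_jumpCount_le hpos hinf t))

lemma tsum_lt_firstTime {q : ℕ → Prop} (hq : firstTime q ≠ ∞) :
    ∑' n : ℕ, (if (n : ℝ≥0∞) < firstTime q then (1 : ℝ≥0∞) else 0) = firstTime q := by
  obtain ⟨N, -, -, hNq⟩ := exists_firstTime_eq hq
  rw [hNq, tsum_eq_sum (s := Finset.range N)]
  · rw [Finset.sum_congr rfl fun i hi => if_pos (by simpa using hi)]
    simp
  · intro i hi
    simp at hi
    simp [hi]

variable {V : Type*}

lemma contPath_image_Iic (hpos : ∀ n, 0 < ξ n) (hinf : ∀ N, ∃ n ≥ N, 1 < ξ n) (Y : ℕ → V)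
    (t : ℝ≥0) : contPath (Y, ξ) '' Set.Iic t = Y '' Set.Iic (jumpCount ξ t) := by
  ext v
  constructor
  · rintro ⟨s, hs, rfl⟩
    exact ⟨jumpCount ξ s, jumpCount_mono hpos hinf hs, rfl⟩
  · rintro ⟨n, hn, rfl⟩
    have hnn := jumpTime_nonneg hpos n
    refine ⟨(jumpTime ξ n).toNNReal, ?_, ?_⟩
    · rw [Set.mem_Iic, ← NNReal.coe_le_coe, Real.coe_toNNReal _ hnn]
      exact ((jumpTime_strictMono hpos).monotone hn).trans (jumpTime_jumpCount_le hpos hinf t)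
    · rw [contPath, jumpCount_of_eq hpos (Real.coe_toNNReal _ hnn)]

variable [Fintype V] [MeasurableSpace V] [DiscreteMeasurableSpace V]

/-- A time at which the jump chain first satisfies some property, and the corresponding time of
the continuous-time chain, have the same expectation: the holding times are independent of the
jump chain and have mean `1`. -/
lemma lintegral_contLaw_eq (C : Chain V) (x : V) (q : (ℕ → V) → ℕ → Prop)
    (hmeas : Measurable fun ω => firstTime (q ω))
    (hfin : ∫⁻ ω, firstTime (q ω) ∂(C.discLaw x) ≠ ∞)
    {F : (ℕ → V) × (ℕ → ℝ) → ℝ≥0∞}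
    (hF : ∀ Y ξ, (∀ n, 0 < ξ n) → (∀ N, ∃ n ≥ N, 1 < ξ n) →
      F (Y, ξ) = ⨅ (t : ℝ≥0) (_ : q Y (jumpCount ξ t)), (t : ℝ≥0∞)) :
    ∫⁻ ω, F ω ∂(C.contLaw x) = ∫⁻ ω, firstTime (q ω) ∂(C.discLaw x) := by
  have hY : ∀ᵐ Y ∂(C.discLaw x), firstTime (q Y) ≠ ∞ := by
    filter_upwards [ae_lt_top hmeas hfin] with Y h using h.ne
  have hind : ∀ n : ℕ, Measurable fun Y : ℕ → V =>
      if (n : ℝ≥0∞) < firstTime (q Y) then (1 : ℝ≥0∞) else 0 := fun n =>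
    Measurable.ite (measurableSet_lt measurable_const hmeas) measurable_const measurable_const
  have hprod : ∀ᵐ ω ∂(C.contLaw x), F ω =
      ∑' n : ℕ, (if (n : ℝ≥0∞) < firstTime (q ω.1) then 1 else 0) * ENNReal.ofReal (ω.2 n) := by
    have h1 : ∀ᵐ ω ∂(C.contLaw x), firstTime (q ω.1) ≠ ∞ :=
      Measure.quasiMeasurePreserving_fst.ae hY
    have h2 : ∀ᵐ ω ∂(C.contLaw x), ∀ n, 0 < ω.2 n :=
      Measure.quasiMeasurePreserving_snd.ae holding_pos
    have h3 : ∀ᵐ ω ∂(C.contLaw x), ∀ N, ∃ n ≥ N, 1 < ω.2 n :=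
      Measure.quasiMeasurePreserving_snd.ae holding_gt_one
    filter_upwards [h1, h2, h3] with ω h1 h2 h3
    rw [← iInf_jumpCount h2 h3 h1, ← hF ω.1 ω.2 h2 h3]
  rw [lintegral_congr_ae hprod, lintegral_tsum fun n => by
    exact (((hind n).comp measurable_fst).mul (by fun_prop)).aemeasurable]
  have hterm : ∀ n : ℕ, ∫⁻ ω, (if (n : ℝ≥0∞) < firstTime (q ω.1) then 1 else 0) *
      ENNReal.ofReal (ω.2 n) ∂(C.contLaw x) =
      ∫⁻ Y, (if (n : ℝ≥0∞) < firstTime (q Y) then 1 else 0) ∂(C.discLaw x) := by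
    intro n
    rw [Chain.contLaw, lintegral_prod_mul (hind n).aemeasurable
      (g := fun ξ : ℕ → ℝ => ENNReal.ofReal (ξ n))
      (by fun_prop : Measurable _).aemeasurable, lintegral_holding, mul_one]
  simp_rw [hterm]
  rw [← lintegral_tsum fun n => (hind n).aemeasurable]
  refine lintegral_congr_ae ?_
  filter_upwards [hY] with Y h using tsum_lt_firstTime h

end Clock

/-! ### The maximum principle -/

section MaximumPrinciple

variable {V : Type*} [Fintype V] [DecidableEq V]

lemma pow_nonneg_entry (C : Chain V) (k : ℕ) (x y : V) : 0 ≤ (C.P ^ k) x y := by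
  induction k generalizing x y with
  | zero =>
    rw [pow_zero, Matrix.one_apply]
    split_ifs <;> norm_num
  | succ k ih =>
    rw [pow_succ, Matrix.mul_apply]
    exact Finset.sum_nonneg fun i _ => mul_nonneg (ih x i) (C.nonneg i y)

lemma exists_pow_pos (C : Chain V) (hirr : C.P.IsIrreducible) (x y : V) :
    ∃ k, 0 < (C.P ^ k) x y := by
  obtain ⟨k, -, hk⟩ := (Matrix.isIrreducible_iff_exists_pow_pos C.nonneg).1 hirr x y
  exact ⟨k, hk⟩

/-- A function that is subharmonic off a nonempty set `S` and nonpositive on `S` is nonpositive: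
the set where a positive maximum is attained would be closed under the transitions of the chain
and disjoint from `S`. -/
lemma nonpos_of_subharmonic (C : Chain V) (hirr : C.P.IsIrreducible) {S : Set V}
    (hS : S.Nonempty) {f : V → ℝ} (hsub : ∀ x ∉ S, f x ≤ ∑ y, C.P x y * f y)
    (hf : ∀ x ∈ S, f x ≤ 0) (x : V) : f x ≤ 0 := by
  obtain ⟨s, hs⟩ := hS
  have : Nonempty V := ⟨s⟩
  obtain ⟨z, hz⟩ := Finite.exists_max f
  refine (hz x).trans ?_
  by_contra hpos
  rw [not_le] at hpos
  have hstep : ∀ u, f u = f z → ∀ w, 0 < C.P u w → f w = f z := by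
    intro u hu w hw
    have huS : u ∉ S := fun h => absurd (hf u h) (by linarith)
    have h1 : ∑ y, C.P u y * (f z - f y) ≤ 0 := by
      have := hsub u huS
      simp only [mul_sub, Finset.sum_sub_distrib, ← Finset.sum_mul, C.row_sum, one_mul]
      linarith
    have h2 : C.P u w * (f z - f w) ≤ 0 :=
      (Finset.single_le_sum (f := fun y => C.P u y * (f z - f y))
        (fun y _ => mul_nonneg (C.nonneg u y) (sub_nonneg.2 (hz y))) (Finset.mem_univ w)).trans h1
    have h3 := nonpos_of_mul_nonpos_right h2 hw
    linarith [hz w]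
  have hpow : ∀ k w, 0 < (C.P ^ k) z w → f w = f z := by
    intro k
    induction k with
    | zero =>
      intro w hw
      rw [pow_zero, Matrix.one_apply] at hw
      split_ifs at hw with h
      · rw [h]
      · exact absurd hw (lt_irrefl _)
    | succ k ih =>
      intro w hw
      rw [pow_succ, Matrix.mul_apply] at hw
      obtain ⟨u, -, hu⟩ := Finset.exists_lt_of_sum_lt (f := fun _ => (0 : ℝ)) (by simpa using hw)
      have hPk := pow_nonneg_entry C k z u
      have hu1 : (C.P ^ k) z u ≠ 0 := fun h => by simp [h] at hu
      have hu2 : C.P u w ≠ 0 := fun h => by simp [h] at hu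
      exact hstep u (ih u (lt_of_le_of_ne hPk hu1.symm)) w
        (lt_of_le_of_ne (C.nonneg u w) hu2.symm)
  obtain ⟨k, hk⟩ := exists_pow_pos C hirr z s
  have := hf s hs
  rw [hpow k s hk] at this
  linarith

lemma eq_const_of_harmonic (C : Chain V) (hirr : C.P.IsIrreducible) {f : V → ℝ}
    (hf : ∀ x, ∑ y, C.P x y * f y = f x) (x y : V) : f x = f y := by
  have key : ∀ x y, f x ≤ f y := by
    intro x y
    have := nonpos_of_subharmonic C hirr (Set.singleton_nonempty y) (f := fun z => f z - f y)
      (fun z _ => by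
        simp only [mul_sub, Finset.sum_sub_distrib, ← Finset.sum_mul, C.row_sum, hf]
        linarith) (fun z hz => by rw [Set.mem_singleton_iff.1 hz]; simp) x
    linarith
  exact le_antisymm (key x y) (key y x)

lemma stationary_pos (C : Chain V) (hirr : C.P.IsIrreducible) {π : V → ℝ}
    (hπ : IsStationary C π) (x : V) : 0 < π x := by
  have hpow : ∀ k : ℕ, Matrix.vecMul π (C.P ^ k) = π := by
    intro k
    induction k with
    | zero => simp
    | succ k ih => rw [pow_succ, ← Matrix.vecMul_vecMul, ih, hπ.2]
  obtain ⟨z, -, hz⟩ := Finset.exists_lt_of_sum_lt (s := Finset.univ) (f := fun _ => (0 : ℝ))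
    (g := π)
    (by simp [hπ.1.2])
  obtain ⟨k, hk⟩ := exists_pow_pos C hirr z x
  rw [← congrFun (hpow k) x]
  exact (mul_pos hz hk).trans_le (Finset.single_le_sum (f := fun z => π z * (C.P ^ k) z x)
    (fun z _ => mul_nonneg (hπ.1.1 z) (pow_nonneg_entry C k z x)) (Finset.mem_univ z))

end MaximumPrinciple

/-! ### Expected visit times -/

section Expected

variable {V : Type*} [Fintype V]

lemma sum_ofReal_row (C : Chain V) (x : V) : ∑ y, ENNReal.ofReal (C.P x y) = 1 := by
  rw [← ENNReal.ofReal_sum_of_nonneg fun y _ => C.nonneg x y, C.row_sum, ENNReal.ofReal_one]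

variable [MeasurableSpace V] [DiscreteMeasurableSpace V]

/-- The expected time at which the discrete-time chain started from `x` has visited all of `U`. -/
noncomputable def visitCost (C : Chain V) (x : V) (U : Finset V) : ℝ≥0∞ :=
  ∫⁻ ω, visitAll ω U ∂(C.discLaw x)

/-- The probability that the discrete-time chain started from `x` visits `y` later than all
of `W`. -/
noncomputable def lastProb (C : Chain V) (x : V) (W : Finset V) (y : V) : ℝ≥0∞ :=
  ∫⁻ ω, (if visitAll ω W < visitTime ω y then 1 else 0) ∂(C.discLaw x)

lemma measurable_last (W : Finset V) (y : V) : Measurable fun ω : ℕ → V =>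
    if visitAll ω W < visitTime ω y then (1 : ℝ≥0∞) else 0 :=
  Measurable.ite (measurableSet_lt (measurable_visitAll W) (measurable_visitTime y))
    measurable_const measurable_const

lemma lastProb_le_one (C : Chain V) (x : V) (W : Finset V) (y : V) : lastProb C x W y ≤ 1 := by
  refine (lintegral_mono (g := fun _ => 1) fun ω => ?_).trans (by simp)
  dsimp only
  split_ifs <;> simp

lemma lastProb_self (C : Chain V) (y : V) (W : Finset V) : lastProb C y W y = 0 := by
  rw [lastProb, lintegral_eq_zero_iff (measurable_last W y)]
  filter_upwards [discLaw_ae_start C y] with ω hω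
  simp [visitTime_of_start hω]

lemma visitCost_empty (C : Chain V) (x : V) : visitCost C x ∅ = 0 := by
  simp [visitCost, visitAll]

lemma lastProb_empty (C : Chain V) {x y : V} (h : x ≠ y) : lastProb C x ∅ y = 1 := by
  have : ∀ᵐ ω ∂(C.discLaw x), (if visitAll ω ∅ < visitTime ω y then (1 : ℝ≥0∞) else 0) = 1 := by
    filter_upwards [discLaw_ae_start C x] with ω hω
    rw [visitTime_shift (hω ▸ h)]
    simp [visitAll]
  rw [lastProb, lintegral_congr_ae this]
  simp

lemma visitCost_le_sum (C : Chain V) (x : V) (U : Finset V) :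
    visitCost C x U ≤ ∑ y ∈ U, visitCost C x {y} := by
  unfold visitCost
  rw [← lintegral_finsetSum _ fun y _ => measurable_visitAll {y}]
  refine lintegral_mono fun ω => Finset.sup_le fun y hy => ?_
  simp only [visitAll, Finset.sup_singleton]
  exact Finset.single_le_sum (f := visitTime ω) (fun _ _ => zero_le) hy

lemma visitCost_step (C : Chain V) {x : V} {U : Finset V} (hU : U.Nonempty) (hx : x ∉ U) :
    visitCost C x U = 1 + ∑ z, ENNReal.ofReal (C.P x z) * visitCost C z U := by
  unfold visitCost
  rw [lintegral_discLaw_step C x (G := fun ω => 1 + visitAll ω U)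
    (measurable_const.add (measurable_visitAll U))
    fun ω hω => visitAll_shift hU (hω ▸ hx)]
  simp_rw [lintegral_add_left measurable_const, lintegral_const, measure_univ, mul_add,
    Finset.sum_add_distrib, mul_one, sum_ofReal_row]

lemma lastProb_step (C : Chain V) {x y : V} {W : Finset V} (hW : W.Nonempty) (hx : x ∉ W)
    (hxy : x ≠ y) :
    lastProb C x W y = ∑ z, ENNReal.ofReal (C.P x z) * lastProb C z W y := by
  refine lintegral_discLaw_step C x (measurable_last W y) fun ω hω => ?_
  rw [visitAll_shift hW (hω ▸ hx), visitTime_shift (hω ▸ hxy)]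
  simp only [ENNReal.add_lt_add_iff_left ENNReal.one_ne_top]

variable [DecidableEq V]

lemma visitCost_erase (C : Chain V) (x : V) (U : Finset V) :
    visitCost C x U = visitCost C x (U.erase x) := by
  refine lintegral_congr_ae ?_
  filter_upwards [discLaw_ae_start C x] with ω hω
  rw [visitAll_erase_start, hω]

lemma lastProb_erase (C : Chain V) (x : V) (W : Finset V) (y : V) :
    lastProb C x W y = lastProb C x (W.erase x) y := by
  refine lintegral_congr_ae ?_
  filter_upwards [discLaw_ae_start C x] with ω hω
  rw [visitAll_erase_start, hω]

/-- A nonnegative supersolution of the first-step equation bounds the expected visit time. -/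
lemma visitCost_singleton_le (C : Chain V) {y : V} {g : V → ℝ} (hg : ∀ x, 0 ≤ g x)
    (hsup : ∀ x, x ≠ y → 1 + ∑ z, C.P x z * g z ≤ g x) (x : V) :
    visitCost C x {y} ≤ ENNReal.ofReal (g x) := by
  -- The truncated times satisfy the bound by induction; then monotone convergence.
  have hmeas : ∀ n : ℕ, Measurable fun ω : ℕ → V => min (visitTime ω y) n :=
    fun n => (measurable_visitTime y).min measurable_const
  have htrunc : ∀ (n : ℕ) x,
      ∫⁻ ω, min (visitTime ω y) n ∂(C.discLaw x) ≤ ENNReal.ofReal (g x) := by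
    intro n
    induction n with
    | zero => simp
    | succ n ih =>
      intro x
      by_cases hxy : x = y
      · have : ∀ᵐ ω ∂(C.discLaw x), min (visitTime ω y) ((n + 1 : ℕ) : ℝ≥0∞) = 0 := by
          filter_upwards [discLaw_ae_start C x] with ω hω
          simp [visitTime_of_start (hω.trans hxy)]
        rw [lintegral_congr_ae this]
        simp
      · rw [lintegral_discLaw_step C x (G := fun ω => 1 + min (visitTime ω y) n)
          (measurable_const.add (hmeas n))]
        · simp_rw [lintegral_add_left measurable_const, lintegral_const, measure_univ, mul_add,
            Finset.sum_add_distrib, mul_one, sum_ofReal_row]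
          calc 1 + ∑ z, ENNReal.ofReal (C.P x z) * ∫⁻ ω, min (visitTime ω y) n ∂(C.discLaw z)
              ≤ 1 + ∑ z, ENNReal.ofReal (C.P x z) * ENNReal.ofReal (g z) := by
                gcongr with z
                exact ih z
            _ = ENNReal.ofReal (1 + ∑ z, C.P x z * g z) := by
                rw [ENNReal.ofReal_add zero_le_one
                  (Finset.sum_nonneg fun z _ => mul_nonneg (C.nonneg x z) (hg z)),
                  ENNReal.ofReal_one, ENNReal.ofReal_sum_of_nonneg
                    fun z _ => mul_nonneg (C.nonneg x z) (hg z)]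
                congr 1
                exact Finset.sum_congr rfl fun z _ => (ENNReal.ofReal_mul (C.nonneg x z)).symm
            _ ≤ _ := ENNReal.ofReal_le_ofReal (hsup x hxy)
        · intro ω hω
          rw [visitTime_shift (hω ▸ hxy)]
          push_cast
          rw [add_comm (n : ℝ≥0∞), min_add_add_left]
  have hsupr : ∀ ω : ℕ → V, visitAll ω {y} = ⨆ n : ℕ, min (visitTime ω y) n := by
    intro ω
    rw [visitAll, Finset.sup_singleton]
    refine le_antisymm ?_ (iSup_le fun n => min_le_left _ _)
    have h := inf_iSup_eq (visitTime ω y) (fun n : ℕ => (n : ℝ≥0∞))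
    rw [ENNReal.iSup_natCast, inf_top_eq] at h
    exact h.le
  rw [visitCost, lintegral_congr hsupr, lintegral_iSup hmeas]
  · exact iSup_le fun n => htrunc n x
  · intro m n hmn ω
    exact min_le_min_left _ (by exact_mod_cast hmn)

lemma one_le_sum_lastProb (C : Chain V) (x : V) (hfin : ∀ y, visitCost C x {y} ≠ ∞)
    {U : Finset V} (hU : 2 ≤ U.card) : 1 ≤ ∑ y ∈ U, lastProb C x (U.erase y) y := by
  have h : ∀ᵐ ω ∂(C.discLaw x), ∀ y, visitTime ω y ≠ ∞ := by
    rw [ae_all_iff]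
    intro y
    have := ae_lt_top (measurable_visitAll {y}) (hfin y)
    filter_upwards [this] with ω hω
    simpa [visitAll] using hω.ne
  unfold lastProb
  rw [← lintegral_finsetSum _ fun y _ => measurable_last _ y]
  calc (1 : ℝ≥0∞) = ∫⁻ _, 1 ∂(C.discLaw x) := by simp
    _ ≤ _ := by
      refine lintegral_mono_ae ?_
      filter_upwards [h] with ω hω
      obtain ⟨y, hy, hlt⟩ := exists_visitAll_erase_lt hU fun y _ => hω y
      refine le_trans (by simp [hlt]) (Finset.single_le_sum
        (f := fun y => if visitAll ω (U.erase y) < visitTime ω y then (1 : ℝ≥0∞) else 0)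
        (fun _ _ => zero_le) hy)

end Expected

/-! ### Spectral decomposition of a reversible chain -/

section Spectral

variable {V : Type*} [Fintype V]

/-- Eigenvalues of a stochastic matrix have modulus at most `1`. -/
lemma abs_le_one_of_eigen (C : Chain V) {f : V → ℝ} {c : ℝ}
    (hf : ∀ x, ∑ y, C.P x y * f y = c * f x) (hne : ∃ x, f x ≠ 0) : |c| ≤ 1 := by
  obtain ⟨x₀, hx₀⟩ := hne
  have : Nonempty V := ⟨x₀⟩
  obtain ⟨z, hz⟩ := Finite.exists_max fun x => |f x|
  have hpos : 0 < |f z| := (abs_pos.2 hx₀).trans_le (hz x₀)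
  have h : |c| * |f z| ≤ 1 * |f z| := by
    rw [← abs_mul, ← hf z, ← C.row_sum z, Finset.sum_mul]
    refine (Finset.abs_sum_le_sum_abs _ _).trans (Finset.sum_le_sum fun y _ => ?_)
    rw [abs_mul, abs_of_nonneg (C.nonneg z y)]
    exact mul_le_mul_of_nonneg_left (hz y) (C.nonneg z y)
  exact le_of_mul_le_mul_right h hpos

variable [DecidableEq V]

/-- If `0` is a simple eigenvalue of `I - P` and the others are positive, then the second entry of
the sorted list of eigenvalues is the least of the others. -/
lemma gap_pos_and_le [Nontrivial V] (C : Chain V) {lam : V → ℝ} {i₀ : V}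
    (hroots : (1 - C.P).charpoly.roots = Finset.univ.val.map lam) (h0 : lam i₀ = 0)
    (hpos : ∀ i, i ≠ i₀ → 0 < lam i) : 0 < gap C ∧ ∀ i, i ≠ i₀ → gap C ≤ lam i := by
  set s := (Finset.univ.erase i₀).val.map lam with hs
  have hmem : ∀ b ∈ s, ∃ i, i ≠ i₀ ∧ lam i = b := by
    intro b hb
    obtain ⟨i, hi, rfl⟩ := Multiset.mem_map.1 hb
    exact ⟨i, Finset.ne_of_mem_erase (Finset.mem_def.2 hi), rfl⟩
  have hmem' : ∀ i, i ≠ i₀ → lam i ∈ s := fun i hi =>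
    Multiset.mem_map_of_mem lam (Finset.mem_def.1 (Finset.mem_erase.2 ⟨hi, Finset.mem_univ i⟩))
  have hcons : (1 - C.P).charpoly.roots = 0 ::ₘ s := by
    rw [hroots, hs, ← h0, ← Multiset.map_cons,
      ← Finset.insert_val_of_notMem (Finset.notMem_erase _ _),
      Finset.insert_erase (Finset.mem_univ _)]
  have hsort : (1 - C.P).charpoly.roots.sort (· ≤ ·) = 0 :: s.sort (· ≤ ·) := by
    rw [hcons, Multiset.sort_cons]
    intro b hb
    obtain ⟨i, hi, rfl⟩ := hmem b hb
    exact (hpos i hi).le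
  have hgap : gap C = (s.sort (· ≤ ·)).getD 0 0 := by
    rw [gap, hsort, List.getD_cons_succ]
  obtain ⟨j, hj⟩ := exists_ne i₀
  rcases hl : s.sort (· ≤ ·) with _ | ⟨a, l⟩
  · have := hmem' j hj
    rw [← Multiset.mem_sort (r := (· ≤ ·)), hl] at this
    simp at this
  · have hga : gap C = a := by rw [hgap, hl]; rfl
    have hpw : (a :: l).Pairwise (· ≤ ·) := hl ▸ Multiset.pairwise_sort s (· ≤ ·)
    have ha : a ∈ s := by
      rw [← Multiset.mem_sort (r := (· ≤ ·)), hl]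
      simp
    rw [hga]
    refine ⟨?_, fun i hi => ?_⟩
    · obtain ⟨i, hi, rfl⟩ := hmem a ha
      exact hpos i hi
    · have := hmem' i hi
      rw [← Multiset.mem_sort (r := (· ≤ ·)), hl] at this
      rcases List.mem_cons.1 this with h | h
      · exact h.ge
      · exact (List.pairwise_cons.1 hpw).1 _ h

/-- A spectral decomposition of `P` in `ℓ²(π)`: eigenfunctions `φ i` of `I - P` with eigenvalues
`lam i`, orthonormal in `ℓ²(π)`; that they form a basis is encoded by the resolution of the
identity `resolution`. The index `i₀` is that of the constants. -/
structure SpectralData (C : Chain V) (π : V → ℝ) where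
  lam : V → ℝ
  φ : V → V → ℝ
  i₀ : V
  eigen : ∀ i x, ∑ y, C.P x y * φ i y = (1 - lam i) * φ i x
  resolution : ∀ x y, ∑ i, φ i x * φ i y = if x = y then (π x)⁻¹ else 0
  const : ∀ x y, φ i₀ x * φ i₀ y = 1
  lam_i₀ : lam i₀ = 0
  mean_zero : ∀ i, i ≠ i₀ → ∑ x, π x * φ i x = 0
  gap_pos : 0 < gap C
  gap_le : ∀ i, i ≠ i₀ → gap C ≤ lam i
  lam_le : ∀ i, lam i ≤ 2

/-- Conjugation by the square root of `π` makes `I - P` symmetric, without changing its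
characteristic polynomial. Irreducibility makes the eigenvalue `0` simple. -/
lemma exists_spectralData [Nontrivial V] (C : Chain V) (hirr : C.P.IsIrreducible) {π : V → ℝ}
    (hπ : IsStationary C π) (hrev : IsReversible C π) : Nonempty (SpectralData C π) := by
  have hpos := stationary_pos C hirr hπ
  set r : V → ℝ := fun x => √(π x) with hr
  have hrpos : ∀ x, 0 < r x := fun x => Real.sqrt_pos.2 (hpos x)
  have hrr : ∀ x, r x * r x = π x := fun x => Real.mul_self_sqrt (hpos x).le
  set S : Matrix V V ℝ :=
    Matrix.diagonal r * (1 - C.P) * Matrix.diagonal (fun x => (r x)⁻¹) with hSdef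
  have hSapply : ∀ x y, S x y = r x * (1 - C.P) x y * (r y)⁻¹ := by
    intro x y
    rw [hSdef, Matrix.mul_diagonal, Matrix.diagonal_mul]
  have hS : S.IsHermitian := by
    refine Matrix.IsHermitian.ext fun x y => ?_
    rw [hSapply, hSapply, star_trivial]
    have hx := (hrpos x).ne'
    have hy := (hrpos y).ne'
    have h1 := hrev x y
    rw [← hrr, ← hrr] at h1
    simp only [Matrix.sub_apply, Matrix.one_apply, eq_comm (a := y) (b := x)]
    field_simp
    split_ifs with hxy
    · subst hxy
      ring
    · linear_combination h1
  have hchar : (1 - C.P).charpoly.roots = Finset.univ.val.map hS.eigenvalues := by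
    have : S.charpoly = (1 - C.P).charpoly := by
      have hDD : Matrix.diagonal (fun x => (r x)⁻¹) * Matrix.diagonal r = 1 := by
        rw [Matrix.diagonal_mul_diagonal, ← Matrix.diagonal_one]
        congr 1
        ext x
        exact inv_mul_cancel₀ (hrpos x).ne'
      rw [hSdef, Matrix.charpoly_mul_comm, ← mul_assoc, hDD, one_mul]
    rw [← this, hS.roots_charpoly_eq_eigenvalues]
    rfl
  set lam := hS.eigenvalues with hlam
  set u : V → V → ℝ := fun i x => hS.eigenvectorBasis i x with hu
  set φ : V → V → ℝ := fun i x => u i x / r x with hφ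
  have hcomp : ∀ x y, ∑ i, u i x * u i y = if x = y then 1 else 0 := by
    intro x y
    have h := Unitary.coe_mul_star_self hS.eigenvectorUnitary
    have h2 := congrFun (congrFun h x) y
    simpa [Matrix.mul_apply, Matrix.star_apply, Matrix.one_apply] using h2
  have horth : ∀ i j, ∑ x, u i x * u j x = if i = j then 1 else 0 := by
    intro i j
    have h := Unitary.coe_star_mul_self hS.eigenvectorUnitary
    have h2 := congrFun (congrFun h i) j
    simpa [Matrix.mul_apply, Matrix.star_apply, Matrix.one_apply] using h2
  have heig : ∀ i x, ∑ y, (1 - C.P) x y * φ i y = lam i * φ i x := by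
    intro i x
    have h := congrFun (hS.mulVec_eigenvectorBasis i) x
    simp only [Matrix.mulVec, dotProduct, hSapply, Pi.smul_apply, smul_eq_mul] at h
    have hx := (hrpos x).ne'
    have h' : r x * ∑ y, (1 - C.P) x y * φ i y = lam i * u i x := by
      rw [← h, Finset.mul_sum]
      refine Finset.sum_congr rfl fun y _ => ?_
      simp only [hφ, hu]
      ring
    have hux : u i x = r x * φ i x := (mul_div_cancel₀ _ hx).symm
    rw [hux] at h'
    exact mul_left_cancel₀ hx (by linarith)
  have heigen : ∀ i x, ∑ y, C.P x y * φ i y = (1 - lam i) * φ i x := by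
    intro i x
    have h := heig i x
    simp only [Matrix.sub_apply, Matrix.one_apply, sub_mul, Finset.sum_sub_distrib, ite_mul,
      one_mul, zero_mul, Finset.sum_ite_eq, Finset.mem_univ, if_true] at h
    linarith
  have hres : ∀ x y, ∑ i, φ i x * φ i y = if x = y then (π x)⁻¹ else 0 := by
    intro x y
    have : ∑ i, φ i x * φ i y = (∑ i, u i x * u i y) * ((r x)⁻¹ * (r y)⁻¹) := by
      rw [Finset.sum_mul]
      refine Finset.sum_congr rfl fun i _ => ?_
      simp only [hφ]
      ring
    rw [this, hcomp]
    split_ifs with h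
    · rw [← h, ← mul_inv, hrr, one_mul]
    · rw [zero_mul]
  have hort : ∀ i j, ∑ x, π x * (φ i x * φ j x) = if i = j then 1 else 0 := by
    intro i j
    rw [← horth]
    refine Finset.sum_congr rfl fun x _ => ?_
    have hx := (hrpos x).ne'
    simp only [hφ]
    rw [← hrr]
    field_simp
  have hne : ∀ i, ∃ x, φ i x ≠ 0 := by
    intro i
    by_contra h
    push Not at h
    simpa [h] using hort i i
  have hbd : ∀ i, |1 - lam i| ≤ 1 := fun i => abs_le_one_of_eigen C (heigen i) (hne i)
  have hmean : ∀ i, lam i ≠ 0 → ∑ x, π x * φ i x = 0 := by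
    intro i hi
    have h1 : ∑ x, π x * ∑ y, C.P x y * φ i y = ∑ y, π y * φ i y := by
      simp_rw [Finset.mul_sum, ← mul_assoc]
      rw [Finset.sum_comm]
      simp_rw [← Finset.sum_mul]
      refine Finset.sum_congr rfl fun y _ => ?_
      have := congrFun hπ.2 y
      rw [Matrix.vecMul, dotProduct] at this
      rw [this]
    simp_rw [heigen] at h1
    have h2 : ∑ x, π x * ((1 - lam i) * φ i x) = (1 - lam i) * ∑ x, π x * φ i x := by
      rw [Finset.mul_sum]
      exact Finset.sum_congr rfl fun x _ => by ring
    rw [h2] at h1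
    have h3 : lam i * ∑ x, π x * φ i x = 0 := by linarith
    exact (mul_eq_zero.1 h3).resolve_left hi
  have hconst : ∀ i, lam i = 0 → ∀ x y, φ i x = φ i y := by
    intro i hi
    exact eq_const_of_harmonic C hirr fun x => by rw [heigen, hi]; ring
  have hone : ∀ i j, lam i = 0 → lam j = 0 → ∀ x y, φ i x * φ j y = if i = j then 1 else 0 := by
    intro i j hi hj x y
    rw [← hort i j]
    have : ∀ z, π z * (φ i z * φ j z) = π z * (φ i x * φ j y) := fun z => by
      rw [hconst i hi z x, hconst j hj z y]
    simp_rw [this]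
    rw [← Finset.sum_mul, hπ.1.2, one_mul]
  obtain ⟨x₀, -⟩ := exists_pair_ne V
  -- Otherwise all `φ i` have mean zero, against the resolution of the identity.
  obtain ⟨i₀, hi₀⟩ : ∃ i, lam i = 0 := by
    by_contra h
    push Not at h
    have h1 : ∑ i, φ i x₀ * ∑ y, π y * φ i y = 1 := by
      simp_rw [Finset.mul_sum]
      rw [Finset.sum_comm]
      have : ∀ y, ∑ i, φ i x₀ * (π y * φ i y) = π y * if x₀ = y then (π x₀)⁻¹ else 0 := by
        intro y
        rw [← hres, Finset.mul_sum]
        exact Finset.sum_congr rfl fun i _ => by ring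
      simp_rw [this]
      simp [(hpos x₀).ne']
    simp [hmean _ (h _)] at h1
  have huniq : ∀ i, i ≠ i₀ → lam i ≠ 0 := by
    intro i hi h
    have h1 := hone i i₀ h hi₀ x₀ x₀
    rw [if_neg hi] at h1
    have h2 := hone i i h h x₀ x₀
    have h3 := hone i₀ i₀ hi₀ hi₀ x₀ x₀
    rw [if_pos rfl] at h2 h3
    rcases mul_eq_zero.1 h1 with h | h
    · simp [h] at h2
    · simp [h] at h3
  have hlampos : ∀ i, i ≠ i₀ → 0 < lam i := fun i hi =>
    lt_of_le_of_ne (by linarith [(abs_le.1 (hbd i)).2]) (huniq i hi).symm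
  obtain ⟨hg1, hg2⟩ := gap_pos_and_le C hchar hi₀ hlampos
  exact ⟨{
    lam := lam
    φ := φ
    i₀ := i₀
    eigen := heigen
    resolution := hres
    const := fun x y => by simpa using hone i₀ i₀ hi₀ hi₀ x y
    lam_i₀ := hi₀
    mean_zero := fun i hi => hmean i (huniq i hi)
    gap_pos := hg1
    gap_le := hg2
    lam_le := fun i => by linarith [(abs_le.1 (hbd i)).1] }⟩

end Spectral

/-! ### The Green function and the size of its superlevel sets -/

namespace SpectralData

variable {V : Type*} [Fintype V] [DecidableEq V] {C : Chain V} {π : V → ℝ}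
  (D : SpectralData C π)

/-- The density with respect to `π` of the inverse of `I - P` on functions of `π`-mean zero. -/
noncomputable def green (x y : V) : ℝ :=
  ∑ i ∈ Finset.univ.erase D.i₀, (D.lam i)⁻¹ * (D.φ i x * D.φ i y)

/-- The `n`-step transition density with respect to `π` of the chain that moves according to `P`
with probability `δ` and stays put otherwise. -/
noncomputable def lazyDensity (δ : ℝ) (n : ℕ) (x y : V) : ℝ :=
  ∑ i, (1 - δ * D.lam i) ^ n * (D.φ i x * D.φ i y)

lemma lam_pos {i : V} (hi : i ≠ D.i₀) : 0 < D.lam i := D.gap_pos.trans_le (D.gap_le i hi)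

lemma green_comm (x y : V) : D.green x y = D.green y x :=
  Finset.sum_congr rfl fun i _ => by ring

lemma sum_erase_eq (x y : V) :
    ∑ i ∈ Finset.univ.erase D.i₀, D.φ i x * D.φ i y = (if x = y then (π x)⁻¹ else 0) - 1 := by
  rw [← D.resolution, ← Finset.add_sum_erase _ _ (Finset.mem_univ D.i₀), D.const]
  ring

lemma sum_P_green (x y : V) :
    ∑ z, C.P x z * D.green z y = D.green x y - ((if x = y then (π x)⁻¹ else 0) - 1) := by
  rw [← D.sum_erase_eq]
  simp_rw [green, Finset.mul_sum]
  rw [Finset.sum_comm, ← Finset.sum_sub_distrib]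
  refine Finset.sum_congr rfl fun i hi => ?_
  have hl := (D.lam_pos (Finset.ne_of_mem_erase hi)).ne'
  have : ∀ z, C.P x z * ((D.lam i)⁻¹ * (D.φ i z * D.φ i y)) =
      (D.lam i)⁻¹ * D.φ i y * (C.P x z * D.φ i z) := fun z => by ring
  simp_rw [this]
  rw [← Finset.mul_sum, D.eigen]
  field_simp

lemma sum_pi_green (y : V) : ∑ x, π x * D.green x y = 0 := by
  simp_rw [green, Finset.mul_sum]
  rw [Finset.sum_comm]
  refine Finset.sum_eq_zero fun i hi => ?_
  have : ∀ x, π x * ((D.lam i)⁻¹ * (D.φ i x * D.φ i y)) =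
      (D.lam i)⁻¹ * D.φ i y * (π x * D.φ i x) := fun x => by ring
  simp_rw [this]
  rw [← Finset.mul_sum, D.mean_zero i (Finset.ne_of_mem_erase hi), mul_zero]

lemma lazyDensity_nonneg (hπ : ∀ x, 0 < π x) {δ : ℝ} (h0 : 0 ≤ δ) (h1 : δ ≤ 1) (n : ℕ) (x y : V) :
    0 ≤ D.lazyDensity δ n x y := by
  induction n generalizing x with
  | zero =>
    simp only [lazyDensity, pow_zero, one_mul, D.resolution]
    split_ifs
    · exact (inv_pos.2 (hπ x)).le
    · exact le_rfl
  | succ n ih =>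
    have : D.lazyDensity δ (n + 1) x y = (1 - δ) * D.lazyDensity δ n x y +
        δ * ∑ z, C.P x z * D.lazyDensity δ n z y := by
      simp_rw [lazyDensity, Finset.mul_sum]
      rw [Finset.sum_comm, ← Finset.sum_add_distrib]
      refine Finset.sum_congr rfl fun i _ => ?_
      have : ∀ z, δ * (C.P x z * ((1 - δ * D.lam i) ^ n * (D.φ i z * D.φ i y))) =
          δ * (1 - δ * D.lam i) ^ n * D.φ i y * (C.P x z * D.φ i z) := fun z => by ring
      simp_rw [this]
      rw [← Finset.mul_sum, D.eigen]
      ring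
    rw [this]
    exact add_nonneg (mul_nonneg (by linarith) (ih x)) (mul_nonneg h0
      (Finset.sum_nonneg fun z _ => mul_nonneg (C.nonneg x z) (ih z)))

lemma sum_pi_lazyDensity (hsum : ∑ x, π x = 1) (δ : ℝ) (n : ℕ) (x : V) :
    ∑ y, π y * D.lazyDensity δ n x y = 1 := by
  simp_rw [lazyDensity, Finset.mul_sum]
  rw [Finset.sum_comm]
  have : ∀ i y, π y * ((1 - δ * D.lam i) ^ n * (D.φ i x * D.φ i y)) =
      (1 - δ * D.lam i) ^ n * D.φ i x * (π y * D.φ i y) := fun i y => by ring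
  simp_rw [this, ← Finset.mul_sum]
  rw [Finset.sum_eq_single D.i₀]
  · rw [D.lam_i₀, mul_zero, sub_zero, one_pow, one_mul, Finset.mul_sum, ← hsum]
    refine Finset.sum_congr rfl fun y _ => ?_
    rw [mul_left_comm, D.const, mul_one]
  · intro i _ hi
    rw [D.mean_zero i hi, mul_zero]
  · simp

lemma lazyDensity_sub_one (δ : ℝ) (n : ℕ) (x y : V) : D.lazyDensity δ n x y - 1 =
    ∑ i ∈ Finset.univ.erase D.i₀, (1 - δ * D.lam i) ^ n * (D.φ i x * D.φ i y) := by
  rw [lazyDensity, ← Finset.add_sum_erase _ _ (Finset.mem_univ D.i₀), D.const, D.lam_i₀]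
  ring

/-- The Green function is the integral of the heat kernel minus `1`; here time is discretized with
mesh `δ`, which costs nothing because the lazy chain has the same Green function. The integral
over times beyond `k * δ` is bounded by means of the spectral gap. -/
lemma green_le {δ : ℝ} (h0 : 0 ≤ δ) (h1 : δ ≤ 1 / 2) (k : ℕ) (x y : V) :
    D.green x y ≤ δ * ∑ n ∈ Finset.range k, (D.lazyDensity δ n x y - 1) +
      Real.exp (-(k * δ * gap C)) * ((D.green x x + D.green y y) / 2) := by
  simp_rw [lazyDensity_sub_one, green, Finset.mul_sum, ← Finset.sum_add_distrib]
  rw [Finset.sum_comm, Finset.sum_div, Finset.mul_sum, ← Finset.sum_add_distrib]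
  refine Finset.sum_le_sum fun i hi => ?_
  have hi' := Finset.ne_of_mem_erase hi
  have hl := D.lam_pos hi'
  have hgeom : δ * ∑ n ∈ Finset.range k, (1 - δ * D.lam i) ^ n =
      (D.lam i)⁻¹ * (1 - (1 - δ * D.lam i) ^ k) := by
    rw [← mul_neg_geom_sum]
    field_simp
    ring
  -- This is where `δ ≤ 1 / 2` is needed: the eigenvalues of `I - P` are at most `2`.
  have hq0 : 0 ≤ 1 - δ * D.lam i := by nlinarith [D.lam_le i]
  have hq : (1 - δ * D.lam i) ^ k ≤ Real.exp (-(k * δ * gap C)) := by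
    have h2 : 1 - δ * D.lam i ≤ Real.exp (-(δ * gap C)) := by
      have h3 := Real.add_one_le_exp (-(δ * D.lam i))
      have h4 : Real.exp (-(δ * D.lam i)) ≤ Real.exp (-(δ * gap C)) :=
        Real.exp_le_exp.2 (neg_le_neg (mul_le_mul_of_nonneg_left (D.gap_le i hi') h0))
      linarith
    calc (1 - δ * D.lam i) ^ k ≤ Real.exp (-(δ * gap C)) ^ k := pow_le_pow_left₀ hq0 h2 k
      _ = _ := by
        rw [← Real.exp_nat_mul]
        congr 1
        ring
  have hsum : ∑ n ∈ Finset.range k, δ * ((1 - δ * D.lam i) ^ n * (D.φ i x * D.φ i y)) =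
      (D.lam i)⁻¹ * (1 - (1 - δ * D.lam i) ^ k) * (D.φ i x * D.φ i y) := by
    rw [← hgeom, Finset.mul_sum, Finset.sum_mul]
    exact Finset.sum_congr rfl fun n _ => by ring
  rw [hsum]
  have ham : D.φ i x * D.φ i y ≤ (D.φ i x * D.φ i x + D.φ i y * D.φ i y) / 2 := by
    nlinarith [sq_nonneg (D.φ i x - D.φ i y)]
  have hsq : 0 ≤ (D.φ i x * D.φ i x + D.φ i y * D.φ i y) / 2 := by
    nlinarith [mul_self_nonneg (D.φ i x), mul_self_nonneg (D.φ i y)]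
  have hfin : (1 - δ * D.lam i) ^ k * (D.φ i x * D.φ i y) ≤
      Real.exp (-(k * δ * gap C)) * ((D.φ i x * D.φ i x + D.φ i y * D.φ i y) / 2) :=
    (mul_le_mul_of_nonneg_left ham (pow_nonneg hq0 k)).trans (mul_le_mul_of_nonneg_right hq hsq)
  have := mul_le_mul_of_nonneg_left hfin (inv_pos.2 hl).le
  linarith

/-- Up to time `t = log (2H/s) / gap` the chain started from `x` spends at every point `z` of `A`
at least `(s/2 + t) π z` units of time, and `t` units of time in all. -/
lemma mass_le_of_le_green (hπ : ∀ x, 0 < π x) (hsum : ∑ x, π x = 1) {H s : ℝ} (hs : 0 < s)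
    (hsH : s < 2 * H) (hH : ∀ x, D.green x x ≤ H) (x : V) {A : Set V}
    (hA : ∀ z ∈ A, s ≤ D.green x z) :
    mass π A ≤ 2 * Real.log (2 * H / s) / (2 * Real.log (2 * H / s) + s * gap C) := by
  classical
  have hHs : 1 < 2 * H / s := (one_lt_div hs).2 hsH
  set L := Real.log (2 * H / s) with hL
  have hLpos : 0 < L := Real.log_pos hHs
  have hg := D.gap_pos
  set t := L / gap C with ht
  have htpos : 0 < t := div_pos hLpos hg
  -- `k` steps of length `t / k ≤ 1 / 2`, so that the lazy chain runs for time exactly `t`.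
  obtain ⟨k, hk⟩ := exists_nat_ge (2 * t)
  have hkpos : (0 : ℝ) < k := by linarith
  set δ := t / k with hδ
  have hδ0 : 0 ≤ δ := (div_pos htpos hkpos).le
  have hδ1 : δ ≤ 1 / 2 := by
    rw [hδ, div_le_iff₀ hkpos]
    linarith
  have hkδ : k * δ = t := mul_div_cancel₀ _ hkpos.ne'
  have hexp : Real.exp (-(k * δ * gap C)) * H = s / 2 := by
    rw [hkδ, ht, div_mul_cancel₀ _ hg.ne', Real.exp_neg, hL, Real.exp_log (by linarith)]
    have : 0 < H := by linarith
    field_simp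
  have hpt : ∀ z ∈ A, s / 2 + t ≤ δ * ∑ n ∈ Finset.range k, D.lazyDensity δ n x z := by
    intro z hz
    have h1 := (hA z hz).trans (D.green_le hδ0 hδ1 k x z)
    have h2 : Real.exp (-(k * δ * gap C)) * ((D.green x x + D.green z z) / 2) ≤ s / 2 := by
      rw [← hexp]
      exact mul_le_mul_of_nonneg_left (by linarith [hH x, hH z]) (Real.exp_pos _).le
    rw [Finset.sum_sub_distrib, mul_sub, Finset.sum_const, Finset.card_range, nsmul_eq_mul, mul_one,
      mul_comm δ k, hkδ] at h1
    rw [hkδ] at h2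
    linarith
  have hocc : (s / 2 + t) * mass π A ≤ t := by
    calc (s / 2 + t) * mass π A = ∑ z, (s / 2 + t) * A.indicator π z := by
          rw [mass, Finset.mul_sum]
      _ ≤ ∑ z, π z * (δ * ∑ n ∈ Finset.range k, D.lazyDensity δ n x z) := by
          refine Finset.sum_le_sum fun z _ => ?_
          by_cases hz : z ∈ A
          · rw [Set.indicator_of_mem hz, mul_comm]
            exact mul_le_mul_of_nonneg_left (hpt z hz) (hπ z).le
          · rw [Set.indicator_of_notMem hz, mul_zero]
            exact mul_nonneg (hπ z).le (mul_nonneg hδ0 (Finset.sum_nonneg fun n _ =>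
              D.lazyDensity_nonneg hπ hδ0 (by linarith) n x z))
      _ = δ * ∑ n ∈ Finset.range k, ∑ z, π z * D.lazyDensity δ n x z := by
          rw [Finset.sum_comm, Finset.mul_sum]
          refine (Finset.sum_congr rfl fun z _ => ?_)
          rw [Finset.mul_sum, Finset.mul_sum, Finset.mul_sum]
          exact Finset.sum_congr rfl fun n _ => by ring
      _ = t := by
          simp_rw [D.sum_pi_lazyDensity hsum]
          rw [Finset.sum_const, Finset.card_range, nsmul_eq_mul, mul_one, mul_comm, hkδ]
  have hfrac : 2 * L / (2 * L + s * gap C) = t / (s / 2 + t) := by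
    rw [ht]
    field_simp
    ring
  rw [hfrac, le_div_iff₀ (by linarith), mul_comm]
  exact hocc

end SpectralData

/-! ### Expected hitting times in terms of the Green function -/

section Hit

variable {V : Type*} [Fintype V] [DecidableEq V] [MeasurableSpace V] [DiscreteMeasurableSpace V]
  {C : Chain V} {π : V → ℝ}

/-- The expected hitting time of `y` from `x` is `G(y, y) - G(x, y)`: both sides vanish at `x = y`
and solve the same first-step equation elsewhere. -/
lemma visitCost_singleton_eq (D : SpectralData C π) (hirr : C.P.IsIrreducible) (x y : V) :
    visitCost C x {y} = ENNReal.ofReal (D.green y y - D.green x y) ∧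
      0 ≤ D.green y y - D.green x y := by
  set g : V → ℝ := fun z => D.green y y - D.green z y with hgdef
  have hg : ∀ z, z ≠ y → g z = 1 + ∑ w, C.P z w * g w := by
    intro z hz
    simp only [hgdef, mul_sub, Finset.sum_sub_distrib, ← Finset.sum_mul, C.row_sum, one_mul,
      D.sum_P_green, if_neg hz]
    ring
  have hgy : g y = 0 := sub_self _
  have hnn : ∀ z, 0 ≤ g z := by
    intro z
    have := nonpos_of_subharmonic C hirr (Set.singleton_nonempty y) (f := fun z => -g z)
      (fun z hz => by
        simp only [mul_neg, Finset.sum_neg_distrib]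
        linarith [hg z hz])
      (fun z hz => by rw [Set.mem_singleton_iff.1 hz, hgy]; simp) z
    linarith
  have hle := visitCost_singleton_le C hnn fun z hz => (hg z hz).ge
  have hfin : ∀ z, visitCost C z {y} ≠ ∞ := fun z =>
    ne_top_of_le_ne_top ENNReal.ofReal_ne_top (hle z)
  set h : V → ℝ := fun z => (visitCost C z {y}).toReal with hhdef
  have hh : ∀ z, z ≠ y → h z = 1 + ∑ w, C.P z w * h w := by
    intro z hz
    have hne : ∀ w ∈ Finset.univ, ENNReal.ofReal (C.P z w) * visitCost C w {y} ≠ ∞ :=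
      fun w _ => ENNReal.mul_ne_top ENNReal.ofReal_ne_top (hfin w)
    simp only [hhdef]
    rw [visitCost_step C (Finset.singleton_nonempty y) (by simpa using hz),
      ENNReal.toReal_add ENNReal.one_ne_top (ENNReal.sum_ne_top.2 hne), ENNReal.toReal_one,
      ENNReal.toReal_sum hne]
    congr 1
    refine Finset.sum_congr rfl fun w _ => ?_
    rw [ENNReal.toReal_mul, ENNReal.toReal_ofReal (C.nonneg z w)]
  have hhy : h y = 0 := by
    simp only [hhdef]
    rw [visitCost_erase]
    simp [visitCost_empty]
  have hgh : g x ≤ h x := by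
    have := nonpos_of_subharmonic C hirr (Set.singleton_nonempty y) (f := fun z => g z - h z)
      (fun z hz => by
        simp only [mul_sub, Finset.sum_sub_distrib]
        linarith [hg z hz, hh z hz])
      (fun z hz => by rw [Set.mem_singleton_iff.1 hz, hgy, hhy]; simp) x
    linarith
  refine ⟨le_antisymm (hle x) ?_, hnn x⟩
  exact (ENNReal.ofReal_le_iff_le_toReal (hfin x)).2 hgh

end Hit

/-! ### Matthews' lower bound for cover times -/

section Matthews

variable {V : Type*} [Fintype V] [MeasurableSpace V] [DiscreteMeasurableSpace V]

lemma toReal_visitCost_step {C : Chain V} (hfin : ∀ x U, visitCost C x U ≠ ∞) {x : V}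
    {U : Finset V} (hU : U.Nonempty) (hx : x ∉ U) : (visitCost C x U).toReal =
      1 + ∑ z, C.P x z * (visitCost C z U).toReal := by
  have hne : ∀ w ∈ Finset.univ, ENNReal.ofReal (C.P x w) * visitCost C w U ≠ ∞ :=
    fun w _ => ENNReal.mul_ne_top ENNReal.ofReal_ne_top (hfin w U)
  rw [visitCost_step C hU hx, ENNReal.toReal_add ENNReal.one_ne_top (ENNReal.sum_ne_top.2 hne),
    ENNReal.toReal_one, ENNReal.toReal_sum hne]
  congr 1
  refine Finset.sum_congr rfl fun w _ => ?_
  rw [ENNReal.toReal_mul, ENNReal.toReal_ofReal (C.nonneg x w)]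

lemma lastProb_ne_top (C : Chain V) (x : V) (W : Finset V) (y : V) : lastProb C x W y ≠ ∞ :=
  ne_top_of_le_ne_top ENNReal.one_ne_top (lastProb_le_one C x W y)

lemma visitCost_mono (C : Chain V) (x : V) {U W : Finset V} (h : U ⊆ W) :
    visitCost C x U ≤ visitCost C x W :=
  lintegral_mono fun _ => Finset.sup_mono h

lemma toReal_lastProb_step (C : Chain V) {x y : V} {W : Finset V} (hW : W.Nonempty) (hx : x ∉ W)
    (hxy : x ≠ y) : (lastProb C x W y).toReal = ∑ z, C.P x z * (lastProb C z W y).toReal := by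
  rw [lastProb_step C hW hx hxy, ENNReal.toReal_sum fun z _ =>
    ENNReal.mul_ne_top ENNReal.ofReal_ne_top (lastProb_ne_top C z W y)]
  refine Finset.sum_congr rfl fun w _ => ?_
  rw [ENNReal.toReal_mul, ENNReal.toReal_ofReal (C.nonneg x w)]

variable [DecidableEq V]

/-- If `y` is visited later than all of `W`, which happens with probability `lastProb C x W y`, then
visiting `y` too takes at least `t` more on average, because the chain is in `W` at the time when
`W` has just been exhausted. The strong Markov property is replaced by the maximum principle for
the difference of the two sides, and induction on `W`. -/
lemma visitCost_insert_ge {C : Chain V} (hirr : C.P.IsIrreducible)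
    (hfin : ∀ x U, visitCost C x U ≠ ∞) {t : ℝ} {y : V} (W : Finset V) (hW : W.Nonempty)
    (hy : y ∉ W) (ht : ∀ w ∈ W, t ≤ (visitCost C w {y}).toReal) (x : V) :
    (visitCost C x W).toReal + t * (lastProb C x W y).toReal ≤
      (visitCost C x (insert y W)).toReal := by
  induction hn : W.card generalizing W x with
  | zero => exact absurd (Finset.card_eq_zero.1 hn) hW.ne_empty
  | succ n ih =>
    set f : Finset V → V → ℝ := fun W x => (visitCost C x W).toReal +
      t * (lastProb C x W y).toReal - (visitCost C x (insert y W)).toReal with hf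
    have hharm : ∀ (W : Finset V), W.Nonempty → ∀ x ∉ insert y W,
        f W x = ∑ z, C.P x z * f W z := by
      intro W hW x hx
      have hxy : x ≠ y := fun h => hx (h ▸ Finset.mem_insert_self _ _)
      have hxW : x ∉ W := fun h => hx (Finset.mem_insert_of_mem h)
      have hmul : ∀ z, C.P x z * (t * (lastProb C z W y).toReal) =
        t * (C.P x z * (lastProb C z W y).toReal) := fun z => by ring
      simp only [hf]
      rw [toReal_visitCost_step hfin hW hxW, toReal_lastProb_step C hW hxW hxy,
        toReal_visitCost_step hfin (Finset.insert_nonempty y W) hx]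
      simp only [mul_sub, mul_add, Finset.sum_sub_distrib, Finset.sum_add_distrib, hmul,
        ← Finset.mul_sum]
      ring
    suffices h : f W x ≤ 0 by
      simp only [hf] at h
      linarith
    refine nonpos_of_subharmonic C hirr (S := {z | z ∈ insert y W}) ⟨y, Finset.mem_insert_self _ _⟩
      (fun z hz => (hharm W hW z hz).le) ?_ x
    intro z hz
    rcases Finset.mem_insert.1 hz with rfl | hzW
    · simp only [hf]
      rw [lastProb_self, visitCost_erase C z (insert z W), Finset.erase_insert hy]
      simp
    have hzy : z ≠ y := fun h => hy (h ▸ hzW)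
    have hreduce : f W z = f (W.erase z) z := by
      simp only [hf]
      rw [visitCost_erase C z W, lastProb_erase C z W, visitCost_erase C z (insert y W),
        Finset.erase_insert_of_ne hzy.symm]
    rw [hreduce]
    rcases (W.erase z).eq_empty_or_nonempty with hemp | hne
    · simp only [hf]
      rw [hemp, visitCost_empty, lastProb_empty C hzy, insert_empty_eq]
      have := ht z hzW
      simp only [ENNReal.toReal_zero, ENNReal.toReal_one]
      linarith
    · rw [hharm _ hne z (by simp [hzy])]
      refine Finset.sum_nonpos fun w _ => mul_nonpos_of_nonneg_of_nonpos (C.nonneg z w) ?_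
      have := ih (W.erase z) hne (fun h => hy (Finset.mem_of_mem_erase h))
        (fun w hw => ht w (Finset.mem_of_mem_erase hw)) w
        (by rw [Finset.card_erase_of_mem hzW]; omega)
      simp only [hf]
      linarith

/-- Each point of `U` is the last one to be visited on some event; averaging the bound
`visitCost_insert_ge` over the points of `U` produces the harmonic number. -/
lemma mul_harmonic_le_visitCost {C : Chain V} (hirr : C.P.IsIrreducible)
    (hfin : ∀ x U, visitCost C x U ≠ ∞) {t : ℝ} (ht0 : 0 ≤ t) {A : Finset V}
    (ht : ∀ x ∈ A, ∀ y ∈ A, x ≠ y → t ≤ (visitCost C x {y}).toReal) {x : V} (hx : x ∈ A)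
    (U : Finset V) (hUA : U ⊆ A) (hxU : x ∉ U) :
    t * harmonic U.card ≤ (visitCost C x U).toReal := by
  induction hn : U.card generalizing U with
  | zero => simp
  | succ n ih =>
    rcases Nat.eq_zero_or_pos n with rfl | hnpos
    · obtain ⟨y, rfl⟩ := Finset.card_eq_one.1 hn
      have hxy : x ≠ y := fun h => hxU (by simp [h])
      have := ht x hx y (hUA (Finset.mem_singleton_self y)) hxy
      simpa using this
    have hstep : ∀ y ∈ U, t * harmonic n + t * (lastProb C x (U.erase y) y).toReal ≤
        (visitCost C x U).toReal := by
      intro y hy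
      have hcard : (U.erase y).card = n := by
        rw [Finset.card_erase_of_mem hy]
        omega
      have h1 := ih (U.erase y) ((Finset.erase_subset _ _).trans hUA)
        (fun h => hxU (Finset.mem_of_mem_erase h)) hcard
      have h2 := visitCost_insert_ge hirr hfin (t := t) (y := y) (U.erase y)
        (Finset.card_pos.1 (by omega)) (Finset.notMem_erase y U)
        (fun w hw => ht w (hUA (Finset.mem_of_mem_erase hw)) y (hUA hy)
          (Finset.ne_of_mem_erase hw)) x
      rw [Finset.insert_erase hy] at h2
      linarith
    have hsum := Finset.sum_le_sum hstep
    have hlast : 1 ≤ ∑ y ∈ U, (lastProb C x (U.erase y) y).toReal := by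
      have h := one_le_sum_lastProb C x (fun y => hfin x {y}) (U := U) (by omega)
      rw [← ENNReal.toReal_sum fun y _ => lastProb_ne_top C x _ y]
      exact (ENNReal.toReal_mono (ENNReal.sum_ne_top.2 fun y _ => lastProb_ne_top C x _ y) h)
    simp only [Finset.sum_add_distrib, Finset.sum_const, hn, nsmul_eq_mul, ← Finset.mul_sum] at hsum
    have h3 : t ≤ t * ∑ y ∈ U, (lastProb C x (U.erase y) y).toReal := by
      nlinarith
    have hn1 : (0 : ℝ) < ((n + 1 : ℕ) : ℝ) := by positivity
    rw [harmonic_succ]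
    push_cast at hsum hn1 ⊢
    have h4 : ((n : ℝ) + 1) * (t * (harmonic n + ((n : ℝ) + 1)⁻¹)) ≤
        ((n : ℝ) + 1) * (visitCost C x U).toReal := by
      have h5 : ((n : ℝ) + 1) * (t * (harmonic n + ((n : ℝ) + 1)⁻¹)) =
          ((n : ℝ) + 1) * (t * harmonic n) + t := by
        field_simp
      rw [h5]
      linarith
    exact le_of_mul_le_mul_left h4 hn1

lemma mul_log_card_le_visitCost {C : Chain V} (hirr : C.P.IsIrreducible)
    (hfin : ∀ x U, visitCost C x U ≠ ∞) {t : ℝ} (ht0 : 0 ≤ t) {A : Finset V}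
    (ht : ∀ x ∈ A, ∀ y ∈ A, x ≠ y → t ≤ (visitCost C x {y}).toReal) {x : V} (hx : x ∈ A) :
    t * Real.log A.card ≤ (visitCost C x Finset.univ).toReal := by
  have h1 := mul_harmonic_le_visitCost hirr hfin ht0 ht hx (A.erase x) (Finset.erase_subset _ _)
    (Finset.notMem_erase x A)
  have h2 := log_add_one_le_harmonic (A.erase x).card
  rw [Finset.card_erase_add_one hx] at h2
  exact (mul_le_mul_of_nonneg_left h2 ht0).trans (h1.trans (ENNReal.toReal_mono (hfin x _)
    (visitCost_mono C x (Finset.subset_univ _))))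

end Matthews

/-! ### Separated sets -/

/-- A maximal subset of `S` whose points lie outside each other's `N`-neighbourhood: the
neighbourhoods of its points, together with the points themselves, cover `S`. -/
lemma exists_separated {V : Type*} [Fintype V] {π : V → ℝ} (hπ : ∀ x, 0 ≤ π x)
    {N : V → Set V} (hN : ∀ x y, y ∈ N x → x ∈ N y) {c p : ℝ} (hc : ∀ x, π x ≤ c)
    (hp : ∀ x, mass π (N x) ≤ p) (S : Set V) :
    ∃ A : Finset V, (A : Set V) ⊆ S ∧ (∀ x ∈ A, ∀ y ∈ A, x ≠ y → y ∉ N x) ∧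
      mass π S ≤ A.card * (c + p) := by
  classical
  set F : Finset (Finset V) := Finset.univ.filter fun A : Finset V =>
    (A : Set V) ⊆ S ∧ ∀ x ∈ A, ∀ y ∈ A, x ≠ y → y ∉ N x with hF
  obtain ⟨A, hA, hmax⟩ := Finset.exists_max_image F Finset.card ⟨∅, by simp [hF]⟩
  obtain ⟨hAS, hsep⟩ := (Finset.mem_filter.1 hA).2
  refine ⟨A, hAS, hsep, ?_⟩
  have hcov : ∀ z ∈ S, z ∈ A ∨ ∃ a ∈ A, z ∈ N a := by
    intro z hz
    by_contra! hcon
    have hins : insert z A ∈ F := by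
      refine Finset.mem_filter.2 ⟨Finset.mem_univ _, ?_, ?_⟩
      · rw [Finset.coe_insert]
        exact Set.insert_subset hz hAS
      · intro x hx y hy hxy
        rcases Finset.mem_insert.1 hx with rfl | hx'
        · rcases Finset.mem_insert.1 hy with rfl | hy
          · exact absurd rfl hxy
          · exact fun h => hcon.2 y hy (hN _ _ h)
        · rcases Finset.mem_insert.1 hy with rfl | hy'
          · exact hcon.2 x hx'
          · exact hsep x hx' y hy' hxy
    have := hmax _ hins
    rw [Finset.card_insert_of_notMem hcon.1] at this
    omega
  calc mass π S ≤ ∑ z, ∑ a ∈ A, (({a} : Set V).indicator π z + (N a).indicator π z) := by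
        refine Finset.sum_le_sum fun z _ => ?_
        have hnn : ∀ a ∈ A, 0 ≤ ({a} : Set V).indicator π z + (N a).indicator π z := fun a _ =>
          add_nonneg (Set.indicator_nonneg (fun _ _ => hπ _) _)
            (Set.indicator_nonneg (fun _ _ => hπ _) _)
        by_cases hz : z ∈ S
        · rw [Set.indicator_of_mem hz]
          rcases hcov z hz with h | ⟨a, ha, h⟩
          · refine le_trans ?_ (Finset.single_le_sum hnn h)
            rw [Set.indicator_of_mem (Set.mem_singleton z)]
            linarith [Set.indicator_nonneg (s := N z) (fun x _ => hπ x) z]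
          · refine le_trans ?_ (Finset.single_le_sum hnn ha)
            rw [Set.indicator_of_mem h]
            linarith [Set.indicator_nonneg (s := ({a} : Set V)) (fun x _ => hπ x) z]
        · rw [Set.indicator_of_notMem hz]
          exact Finset.sum_nonneg hnn
    _ = ∑ a ∈ A, (π a + mass π (N a)) := by
        rw [Finset.sum_comm]
        refine Finset.sum_congr rfl fun a _ => ?_
        rw [Finset.sum_add_distrib, mass]
        congr 1
        simp [Set.indicator_apply]
    _ ≤ ∑ a ∈ A, (c + p) := Finset.sum_le_sum fun a _ => add_le_add (hc a) (hp a)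
    _ = A.card * (c + p) := by rw [Finset.sum_const, nsmul_eq_mul]

/-- Markov's inequality for a function bounded from above by `H`. -/
lemma sum_mul_le_mul_mass {V : Type*} [Fintype V] {π : V → ℝ} (hπ : π ∈ stdSimplex ℝ V) {f : V → ℝ}
    {H : ℝ} (hf : ∀ y, f y ≤ H) {s : ℝ} (hs : 0 ≤ s) :
    ∑ y, π y * f y ≤ H * mass π {y | s ≤ f y} + s := by
  have hsum : s = ∑ y, π y * s := by rw [← Finset.sum_mul, hπ.2, one_mul]
  calc ∑ y, π y * f y ≤ ∑ y, (H * {y | s ≤ f y}.indicator π y + π y * s) := by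
        refine Finset.sum_le_sum fun y _ => ?_
        have hy0 := hπ.1 y
        by_cases hy : s ≤ f y
        · rw [Set.indicator_of_mem (show y ∈ {y | s ≤ f y} from hy)]
          nlinarith [mul_le_mul_of_nonneg_left (hf y) hy0, mul_nonneg hy0 hs]
        · rw [Set.indicator_of_notMem (show y ∉ {y | s ≤ f y} from hy), mul_zero, zero_add]
          exact mul_le_mul_of_nonneg_left (not_le.1 hy).le hy0
    _ = H * mass π {y | s ≤ f y} + s := by
        rw [Finset.sum_add_distrib, ← hsum, mass, Finset.mul_sum]

/-! ### The two time models -/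

section Models

variable {V : Type*} [Fintype V] [MeasurableSpace V] [DiscreteMeasurableSpace V]

lemma visitCost_singleton (C : Chain V) (x y : V) :
    visitCost C x {y} = ∫⁻ ω, visitTime ω y ∂(C.discLaw x) := by
  simp [visitCost, visitAll]

lemma expHit_eq (C : Chain V) (hfin : ∀ x U, visitCost C x U ≠ ∞) (m : TimeModel) (x y : V) :
    expHit C m x y = visitCost C x {y} := by
  rw [visitCost_singleton]
  cases m with
  | discrete => rfl
  | continuous =>
    exact lintegral_contLaw_eq C x (fun Y n => Y n = y) (measurable_visitTime y)
      (by simpa [visitCost_singleton, visitTime] using hfin x {y}) fun Y ξ _ _ => rfl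

lemma expCover_eq (C : Chain V) (hfin : ∀ x U, visitCost C x U ≠ ∞) (m : TimeModel) (x : V) :
    expCover C m x = visitCost C x Finset.univ := by
  have h : visitCost C x Finset.univ =
      ∫⁻ Y, firstTime (fun n => Y '' Set.Iic n = Set.univ) ∂(C.discLaw x) := by
    simp_rw [firstTime_cover]
    rfl
  rw [h]
  cases m with
  | discrete => rfl
  | continuous =>
    refine lintegral_contLaw_eq C x (fun Y n => Y '' Set.Iic n = Set.univ) ?_ ?_ ?_
    · simp_rw [firstTime_cover]
      exact measurable_visitAll _
    · rw [← h]
      exact hfin x _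
    · intro Y ξ hpos hinf
      simp only [coverTime, contPath_image_Iic hpos hinf]

end Models

end RevChain

open RevChain in
theorem proposition1p5 {V : Type*} [Fintype V] [DecidableEq V] [Nontrivial V]
    [MeasurableSpace V] [DiscreteMeasurableSpace V]
    (C : RevChain.Chain V) (hirr : C.P.IsIrreducible)
    (π : V → ℝ) (hπ : IsStationary C π) (hrev : IsReversible C π)
    (m : TimeModel) :
    -- all the expectations involved are finite
    ((∀ x y, expHit C m x y ≠ ∞) ∧ (∀ x, expCover C m x ≠ ∞)) ∧
    (∀ x : V, ∀ ε ∈ Set.Ioo (0 : ℝ) 1,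
      mass π (B C m π x ε) ≤
        2 * Real.log (2 * maxHit C m / (ε * alpha C m π)) /
          (2 * Real.log (2 * maxHit C m / (ε * alpha C m π)) + ε * alpha C m π * gap C)) ∧
    tCov C m ≥
      alpha C m π / 4 *
        Real.log (M (maxHit C m / alpha C m π) (alpha C m π * gap C) (piMax π)) := by
  obtain ⟨D⟩ := exists_spectralData C hirr hπ hrev
  have hpos := stationary_pos C hirr hπ
  have hsum : ∑ x, π x = 1 := hπ.1.2
  have hfin : ∀ x U, visitCost C x U ≠ ∞ := fun x U =>
    ne_top_of_le_ne_top (ENNReal.sum_ne_top.2 fun y _ => by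
      rw [(visitCost_singleton_eq D hirr x y).1]
      exact ENNReal.ofReal_ne_top) (visitCost_le_sum C x U)
  have hhit : ∀ x y, hit C m x y = D.green y y - D.green x y := fun x y => by
    rw [hit, expHit_eq C hfin, (visitCost_singleton_eq D hirr x y).1,
      ENNReal.toReal_ofReal (visitCost_singleton_eq D hirr x y).2]
  have halphaAt : ∀ y, alphaAt C m π y = D.green y y := fun y => by
    simp_rw [alphaAt, hhit, mul_sub, Finset.sum_sub_distrib, D.sum_pi_green]
    rw [← Finset.sum_mul, hsum, one_mul, sub_zero]
  have halpha : alpha C m π = ∑ y, π y * D.green y y := by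
    simp_rw [alpha, ← halphaAt, alphaAt, Finset.mul_sum]
    rw [Finset.sum_comm]
    exact Finset.sum_congr rfl fun y _ => Finset.sum_congr rfl fun x _ => by ring
  set α := alpha C m π with hα
  set H := maxHit C m with hH
  have hhitH : ∀ x y, hit C m x y ≤ H := fun x y =>
    le_ciSup (f := fun p : V × V => hit C m p.1 p.2) (Set.finite_range _).bddAbove (x, y)
  have hgreenH : ∀ x, D.green x x ≤ H := fun x => by
    rw [← halphaAt, alphaAt, ← one_mul H, ← hsum, Finset.sum_mul]
    exact Finset.sum_le_sum fun z _ => mul_le_mul_of_nonneg_left (hhitH z x) (hpos z).le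
  have hhit0 : ∀ x y, 0 ≤ hit C m x y := fun x y => ENNReal.toReal_nonneg
  have hα0 : 0 < α := by
    obtain ⟨x, y, hxy⟩ := exists_pair_ne V
    have hxy1 : 0 < hit C m x y := by
      rw [hit, expHit_eq C hfin, toReal_visitCost_step hfin (Finset.singleton_nonempty y)
        (by simpa using hxy)]
      exact add_pos_of_pos_of_nonneg one_pos (Finset.sum_nonneg fun z _ =>
        mul_nonneg (C.nonneg x z) ENNReal.toReal_nonneg)
    have hnn : ∀ x y, 0 ≤ π x * π y * hit C m x y := fun x y =>
      mul_nonneg (mul_nonneg (hpos x).le (hpos y).le) (hhit0 x y)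
    exact Finset.sum_pos' (fun x _ => Finset.sum_nonneg fun y _ => hnn x y)
      ⟨x, Finset.mem_univ x, Finset.sum_pos' (fun y _ => hnn x y)
        ⟨y, Finset.mem_univ y, mul_pos (mul_pos (hpos x) (hpos y)) hxy1⟩⟩
  have hαH : α ≤ H := by
    rw [halpha, ← one_mul H, ← hsum, Finset.sum_mul]
    exact Finset.sum_le_sum fun z _ => mul_le_mul_of_nonneg_left (hgreenH z) (hpos z).le
  have hH0 : 0 < H := hα0.trans_le hαH
  -- By symmetry of the Green function, both conditions in the definition of `B` say the same.
  have hB : ∀ x ε z, z ∈ B C m π x ε ↔ ε * α ≤ D.green x z := by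
    intro x ε z
    rw [B, Set.mem_ofPred_eq, hhit, hhit, halphaAt, halphaAt, D.green_comm z x]
    constructor
    · rintro ⟨h, -⟩
      linarith
    · intro h
      constructor <;> linarith
  have hmass : ∀ x : V, ∀ ε ∈ Set.Ioo (0 : ℝ) 1, mass π (B C m π x ε) ≤
      2 * Real.log (2 * H / (ε * α)) / (2 * Real.log (2 * H / (ε * α)) + ε * α * gap C) := by
    rintro x ε ⟨hε0, hε1⟩
    exact D.mass_le_of_le_green hpos hsum (mul_pos hε0 hα0) (by nlinarith) hgreenH x
      fun z hz => (hB x ε z).1 hz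
  refine ⟨⟨fun x y => ?_, fun x => ?_⟩, hmass, ?_⟩
  · rw [expHit_eq C hfin]
    exact hfin x _
  · rw [expCover_eq C hfin]
    exact hfin x _
  set a := H / α with ha
  have ha1 : 1 ≤ a := (one_le_div hα0).2 hαH
  set L := Real.log (8 * a) with hL
  have hLpos : 0 < L := Real.log_pos (by linarith)
  have hg := D.gap_pos
  set p := 8 * L / (8 * L + α * gap C) with hp
  have hp0 : 0 < p := by positivity
  have hc : ∀ x, π x ≤ piMax π := fun x => le_ciSup (Set.finite_range _).bddAbove x
  have hmassp : ∀ x, mass π (B C m π x (1 / 4)) ≤ p := by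
    intro x
    refine (hmass x (1 / 4) ⟨by norm_num, by norm_num⟩).trans_eq ?_
    have : 2 * H / (1 / 4 * α) = 8 * a := by
      rw [ha]
      field_simp
      norm_num
    rw [this, ← hL, hp]
    field_simp
    ring
  -- `ε = 1/4` makes `2H/(εα) = 8a`, and leaves hitting times at least `α/2 - α/4` within `A`.
  obtain ⟨A, hAS, hsep, hcard⟩ := exists_separated (fun x => (hpos x).le)
    (N := fun x => B C m π x (1 / 4))
    (fun x y h => by rw [hB, D.green_comm]; exact (hB _ _ _).1 h) hc hmassp
    {y | α / 2 ≤ D.green y y}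
  have hc0 : 0 < piMax π := (hpos (Classical.arbitrary V)).trans_le (hc _)
  have hS : 1 / (2 * a) ≤ mass π {y | α / 2 ≤ D.green y y} := by
    have h1 := sum_mul_le_mul_mass hπ.1 hgreenH (half_pos hα0).le
    rw [← halpha] at h1
    rw [ha, div_le_iff₀ (by positivity)]
    have : α * (mass π {y | α / 2 ≤ D.green y y} * (2 * (H / α))) =
        2 * (H * mass π {y | α / 2 ≤ D.green y y}) := by
      field_simp
    nlinarith
  have hM0 : 0 < M a (α * gap C) (piMax π) := by
    rw [M]
    positivity
  have hMcard : M a (α * gap C) (piMax π) ≤ A.card := by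
    rw [M, ← hL, ← hp, div_le_iff₀ (by positivity)]
    refine le_trans ?_ (hS.trans hcard)
    exact one_div_le_one_div_of_le (by positivity) (by linarith)
  have hAne : A.Nonempty := by
    rw [← Finset.card_pos]
    exact_mod_cast hM0.trans_le hMcard
  obtain ⟨x, hx⟩ := hAne
  have hlog := mul_log_card_le_visitCost hirr hfin (t := α / 4) (by linarith) (A := A)
    (fun x hx y hy hxy => by
      have h1 := hsep x hx y hy hxy
      rw [hB, not_le] at h1
      have h2 : α / 2 ≤ D.green y y := hAS hy
      rw [← expHit_eq C hfin m, ← hit, hhit]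
      linarith) hx
  have htcov : (visitCost C x Finset.univ).toReal ≤ tCov C m := by
    rw [← expCover_eq C hfin m]
    exact le_ciSup (f := fun x => (expCover C m x).toReal) (Set.finite_range _).bddAbove x
  exact (mul_le_mul_of_nonneg_left (Real.log_le_log hM0 hMcard) (by linarith)).trans
    (hlog.trans htcov)
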